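/- Let $H=(V,F)$ be a finite hypergraph: $V$ is a finite set and $F$ a set of non-empty subsets of $V$. Write $d_i=|\{\alpha\in F: i\in\alpha\}|$. **Exponential families.** For a ($\sigma$-finite) measure space $(\mathcal X,\nu)$ and a measurable $\phi:\mathcal X\to\mathbb R^n$, put $\psi(\theta)=\log\int e^{\langle\theta,\phi\rangle}d\nu$ and $\Theta=\operatorname{int}\{\theta:\psi(\theta)<\infty\}$. The family consists of the distributions with density $p_\theta=e^{\langle\theta,\phi\rangle-\psi(\theta)}$ with respect to $\nu$, $\theta\in\Theta$. Put $\Lambda(\theta)=\mathbb E_{p_\theta}[\phi]$, $Y=\Lambda(\Theta)$ and $\varphi(\eta)=\sup_{\theta\in\Theta}(\langle\theta,\eta\rangle-\psi(\theta))$. **Inference family.** For each $i\in V$ let $\mathcal E_i$ be the exponential family on $(\mathcal X_i,\nu_i)$ with statistic $\phi_i:\mathcal X_i\to\mathbb R^{r_i}$, and for each $\alpha\in F$ let $\mathcal E_\alpha$ be the exponential family on $\prod_{i\in\alpha}\mathcal X_i$ with base measure $\prod_{i\in\alpha}\nu_i$ and statistic $\phi_\alpha=(\phi_{\langle\alpha\rangle},(\phi_i)_{i\in\alpha})$,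 where $\phi_{\langle\alpha\rangle}$ takes values in $\mathbb R^{s_\alpha}$. Assume that the Hessians of all the log partition functions $\psi_i$ and $\psi_\alpha$ are invertible at every point of $\Theta_i$ and $\Theta_\alpha$ respectively, and that for $i\in\alpha$ the marginal on $\mathcal X_i$ of every member of $\mathcal E_\alpha$ belongs to $\mathcal E_i$. **Bethe free energy.** Let $L$ be the set of $\eta=\{\eta_{\langle\alpha\rangle},\eta_i\}_{\alpha\in F,i\in V}$ with $\eta_i\in Y_i$ for all $i\in V$ and $\eta_\alpha:=(\eta_{\langle\alpha\rangle},(\eta_i)_{i\in\alpha})\in Y_\alpha$ for all $\alpha\in F$. For given vectors $\bar\theta_\alpha$ (the parameters of the compatibility functions $\Psi_\alpha=e^{\langle\bar\theta_\alpha,\phi_\alpha\rangle}$) the Bethe free energy is $$F(\eta)=-\sum_{\alpha\in F}\langle\bar\theta_\alpha,\eta_\alpha\rangle+\sum_{\alpha\in F}\varphi_\alpha(\eta_\alpha)+\sum_{i\in V}(1-d_i)\varphi_i(\eta_i).$$ **Weights.** A point $\eta\in L$ determines the members $b_\alpha\in\mathcal E_\alpha$ and $b_i\in\mathcal E_i$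 with expectation parameters $\eta_\alpha$ and $\eta_i$. For $i,j\in\alpha$ put $u^\alpha_{i\to j}=\operatorname{Var}_{b_j}(\phi_j)^{-1}\operatorname{Cov}_{b_\alpha}(\phi_j,\phi_i)$, an $r_j\times r_i$ matrix. Let $\vec E$ be the set of directed edges $(\alpha\to i)$ with $i\in\alpha\in F$. For $e=(\alpha\to i)$ and $e'=(\beta\to j)$ write $e'\rightharpoonup e$ if $j\in\alpha$, $j\ne i$ and $\beta\ne\alpha$. Let $\mathcal M(u)$ be the complex block matrix indexed by $\vec E$ whose $(e,e')$ block, of size $r_i\times r_j$, is $u^\alpha_{j\to i}$ if $e'\rightharpoonup e$ and $0$ otherwise. **Theorem.** Let $\eta\in L$ and let $u$ be the weights given by $\eta$. If no eigenvalue of $\mathcal M(u)$ is a real number $\ge 1$, then $F$ is twice continuously differentiable at $\eta$ and its Hessian $\nabla^2F(\eta)$ with respect to the coordinates $\{\eta_{\langle\alpha\rangle},\eta_i\}$ is a positive definite matrix. -/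

import Mathlib

open MeasureTheory ProbabilityTheory

noncomputable section

namespace Bethe

/-- The Hessian matrix of `f` at `x`: its `(a, b)` entry is the second partial derivative of `f`
in the coordinate directions `a` and `b`. -/
def hessian {ι : Type*} [Fintype ι] [DecidableEq ι] (f : (ι → ℝ) → ℝ) (x : ι → ℝ) :
    Matrix ι ι ℝ :=
  Matrix.of fun a b => fderiv ℝ (fderiv ℝ f) x (Pi.single a 1) (Pi.single b 1)

/-- The matrix of covariances of the components of `f` with those of `g`. -/
def covMatrix {X ι κ : Type*} [MeasurableSpace X] (μ : Measure X)
    (f : X → ι → ℝ) (g : X → κ → ℝ) : Matrix ι κ ℝ :=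
  Matrix.of fun a b => covariance (fun x => f x a) (fun x => g x b) μ

/-! ### Exponential families -/

section ExponentialFamily

variable {X ι : Type*} [MeasurableSpace X] [Fintype ι] (ν : Measure X) (φ : X → ι → ℝ)

/-- The log partition function `ψ θ = log ∫ exp ⟨θ, φ⟩ dν`. -/
def logPartition (θ : ι → ℝ) : ℝ :=
  Real.log (∫ x, Real.exp (θ ⬝ᵥ φ x) ∂ν)

/-- The set `Θ` of natural parameters: the interior of the set where `ψ` is finite. -/
def naturalParams : Set (ι → ℝ) :=
  interior {θ | Integrable (fun x => Real.exp (θ ⬝ᵥ φ x)) ν}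

/-- The member of the exponential family with natural parameter `θ`: the distribution whose density
with respect to `ν` is `exp (⟨θ, φ⟩ - ψ θ)`. -/
def expDist (θ : ι → ℝ) : Measure X :=
  ν.withDensity fun x => ENNReal.ofReal (Real.exp (θ ⬝ᵥ φ x - logPartition ν φ θ))

/-- The map `Λ` from natural parameters to expectation parameters. -/
def expectationMap (θ : ι → ℝ) : ι → ℝ :=
  fun a => ∫ x, φ x a ∂(expDist ν φ θ)

/-- The set `Y = Λ(Θ)` of expectation parameters. -/
def expectationParams : Set (ι → ℝ) :=
  expectationMap ν φ '' naturalParams ν φ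

/-- The Legendre transform of the log partition function. -/
def legendre (η : ι → ℝ) : ℝ :=
  ⨆ θ : naturalParams ν φ, ((θ : ι → ℝ) ⬝ᵥ η - logPartition ν φ θ)

/-- The member of the exponential family with expectation parameter `η ∈ Y`. -/
def distOfMean (η : ι → ℝ) : Measure X :=
  expDist ν φ (Function.invFunOn (expectationMap ν φ) (naturalParams ν φ) η)

end ExponentialFamily

/-! ### Hypergraphs and inference families -/

/-- A hypergraph on the vertex set `V`: a finite set of non-empty subsets of `V`. -/
structure Hypergraph (V : Type*) where
  hyperedges : Finset (Finset V)
  nonempty_of_mem : ∀ α ∈ hyperedges, α.Nonempty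

namespace Hypergraph

variable {V : Type*} (H : Hypergraph V)

/-- The hyperedges (factors), as a type. -/
abbrev Factor : Type _ := {α : Finset V // α ∈ H.hyperedges}

/-- The directed edges `α → i`, for a hyperedge `α` and a vertex `i ∈ α`. -/
abbrev DirEdge : Type _ := Σ α : H.Factor, {i : V // i ∈ α.1}

/-- The degree of a vertex: the number of hyperedges that contain it. -/
def degree [DecidableEq V] (i : V) : ℕ := (H.hyperedges.filter fun α => i ∈ α).card

/-- `Feeds e' e` for `e' = (β → j)` and `e = (α → i)` says that `j ∈ α`, `j ≠ i` and `β ≠ α`. -/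
def Feeds (e' e : H.DirEdge) : Prop :=
  (e'.2 : V) ∈ e.1.1 ∧ (e'.2 : V) ≠ (e.2 : V) ∧ e'.1 ≠ e.1

end Hypergraph

/-- Base measures and sufficient statistics for the vertices and the factors of a hypergraph.
The statistic of a factor `α` consists of `φF α` together with the `φ i`, `i ∈ α`. -/
structure FamilyData {V : Type*} (H : Hypergraph V) (X : V → Type*)
    [∀ i, MeasurableSpace (X i)] where
  ν : ∀ i, Measure (X i)
  sigmaFinite : ∀ i, SigmaFinite (ν i)
  /-- The dimension of `φ i`. -/
  r : V → ℕ
  /-- The dimension of `φF α`. -/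
  s : H.Factor → ℕ
  φ : ∀ i, X i → Fin (r i) → ℝ
  φF : ∀ α : H.Factor, (∀ i : {i : V // i ∈ α.1}, X i) → Fin (s α) → ℝ
  measurable_φ : ∀ i, Measurable (φ i)
  measurable_φF : ∀ α, Measurable (φF α)

namespace FamilyData

variable {V : Type*} {H : Hypergraph V} {X : V → Type*}
  [∀ i, MeasurableSpace (X i)] (D : FamilyData H X)

/-- The index set of the components of the full sufficient statistic of the factor `α`. -/
abbrev FactorIdx (α : H.Factor) : Type _ :=
  Fin (D.s α) ⊕ (Σ i : {i : V // i ∈ α.1}, Fin (D.r i))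

/-- The product base measure on the configurations of the factor `α`. -/
def νFactor (α : H.Factor) : Measure (∀ i : {i : V // i ∈ α.1}, X i) :=
  Measure.pi fun i => D.ν i

/-- The full sufficient statistic of the factor `α`. -/
def φFactor (α : H.Factor) (x : ∀ i : {i : V // i ∈ α.1}, X i) : D.FactorIdx α → ℝ :=
  Sum.elim (D.φF α x) fun p => D.φ p.1 (x p.1) p.2

end FamilyData

/-- An inference family: all log partition functions have invertible Hessians, and the marginal at
`i ∈ α` of every member of the family of the factor `α` is a member of the family of `i`. -/
structure InferenceFamily {V : Type*} [DecidableEq V] (H : Hypergraph V) (X : V → Type*)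
    [∀ i, MeasurableSpace (X i)] extends FamilyData H X where
  isUnit_hessian_vertex : ∀ i, ∀ θ ∈ naturalParams (ν i) (φ i),
    IsUnit (hessian (logPartition (ν i) (φ i)) θ)
  isUnit_hessian_factor : ∀ α, ∀ θ ∈ naturalParams (toFamilyData.νFactor α) (toFamilyData.φFactor α),
    IsUnit (hessian (logPartition (toFamilyData.νFactor α) (toFamilyData.φFactor α)) θ)
  marginally_closed : ∀ (α : H.Factor) (i : {i : V // i ∈ α.1}),
    ∀ θ ∈ naturalParams (toFamilyData.νFactor α) (toFamilyData.φFactor α),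
      ∃ θ' ∈ naturalParams (ν i) (φ i),
        (expDist (toFamilyData.νFactor α) (toFamilyData.φFactor α) θ).map (fun x => x i) =
          expDist (ν i) (φ i) θ'

namespace InferenceFamily

variable {V : Type*} [Fintype V] [DecidableEq V] {H : Hypergraph V} {X : V → Type*}
  [∀ i, MeasurableSpace (X i)] (I : InferenceFamily H X)

/-- The index set of the coordinates of a point `{η_⟨α⟩, η_i}` of `L`. -/
abbrev Coord : Type _ := (Σ α : H.Factor, Fin (I.s α)) ⊕ (Σ i : V, Fin (I.r i))

/-- The component `η_i`. -/
def etaVertex (η : I.Coord → ℝ) (i : V) : Fin (I.r i) → ℝ :=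
  fun k => η (Sum.inr ⟨i, k⟩)

/-- The expectation parameter `(η_⟨α⟩, (η_i)_{i ∈ α})` of the factor `α`; the local consistency
constraint of `L` is built in, because the block of `i` is the common value `η_i`. -/
def etaFactor (η : I.Coord → ℝ) (α : H.Factor) : I.FactorIdx α → ℝ :=
  Sum.elim (fun k => η (Sum.inl ⟨α, k⟩)) fun p => I.etaVertex η p.1 p.2

/-- The set `L` of (expectation parameters of) pseudomarginals, in the coordinates
`{η_⟨α⟩, η_i}`. -/
def L : Set (I.Coord → ℝ) :=
  {η | (∀ α, I.etaFactor η α ∈ expectationParams (I.νFactor α) (I.φFactor α)) ∧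
    ∀ i, I.etaVertex η i ∈ expectationParams (I.ν i) (I.φ i)}

/-- The Bethe free energy for the compatibility functions `exp ⟨θbar α, φFactor α⟩`. -/
def betheFreeEnergy (θbar : ∀ α : H.Factor, I.FactorIdx α → ℝ) (η : I.Coord → ℝ) : ℝ :=
  -∑ α : H.Factor, θbar α ⬝ᵥ I.etaFactor η α
    + ∑ α : H.Factor, legendre (I.νFactor α) (I.φFactor α) (I.etaFactor η α)
    + ∑ i : V, (1 - (H.degree i : ℝ)) * legendre (I.ν i) (I.φ i) (I.etaVertex η i)

/-- The vertex belief `b_i` given by `η`. -/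
def beliefVertex (η : I.Coord → ℝ) (i : V) : Measure (X i) :=
  distOfMean (I.ν i) (I.φ i) (I.etaVertex η i)

/-- The factor belief `b_α` given by `η`. -/
def beliefFactor (η : I.Coord → ℝ) (α : H.Factor) : Measure (∀ i : {i : V // i ∈ α.1}, X i) :=
  distOfMean (I.νFactor α) (I.φFactor α) (I.etaFactor η α)

/-- The weight `u^α_{i → j} = Var_{b_j}(φ_j)⁻¹ Cov_{b_α}(φ_j, φ_i)`. -/
def weight (η : I.Coord → ℝ) (α : H.Factor) (i j : {i : V // i ∈ α.1}) :
    Matrix (Fin (I.r j)) (Fin (I.r i)) ℝ :=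
  (covMatrix (I.beliefVertex η j) (I.φ j) (I.φ j))⁻¹ *
    covMatrix (I.beliefFactor η α) (fun x => I.φ j (x j)) (fun x => I.φ i (x i))

end InferenceFamily

open Classical in
/-- The matrix `M(u)` on the functions `f` on directed edges with `f e ∈ ℂ^{r (t e)}`. For
`e = (α → i)` and `e' = (β → j)` its `(e, e')` block is `u^α_{j → i}` if `e'` feeds `e`, and `0`
otherwise. -/
def edgeMatrix {V : Type*} {H : Hypergraph V} {r : V → ℕ}
    (u : ∀ (α : H.Factor) (i j : {i : V // i ∈ α.1}), Matrix (Fin (r j)) (Fin (r i)) ℂ) :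
    Matrix (Σ e : H.DirEdge, Fin (r e.2)) (Σ e : H.DirEdge, Fin (r e.2)) ℂ :=
  Matrix.of fun p q =>
    if h : H.Feeds q.1 p.1 then u p.1.1 ⟨q.1.2, h.1⟩ p.1.2 p.2 q.2 else 0

end Bethe

end

/-!
By Legendre duality the Hessian of `φ_α` at `η_α` is the inverse of the covariance matrix `C_α` of
the statistic `φ_α` under `b_α`, and likewise for the vertices. So `∇²F` is an explicit function of
the covariance matrices, and it is block diagonal and positive definite when `C_α` is replaced by
`D_α = diag(1, Var_{b_i}(φ_i) : i ∈ α)`. Move from `D_α` to `C_α` along `t C_α + (1 - t) D_α`,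
`t ∈ [0, 1]`. This scales the weights by `t`, so a kernel vector of the Hessian at `t` yields a real
vector `f ≠ 0` with `t M(u) f = f`: it would make `1 / t ≥ 1` an eigenvalue of `M(u)`. Hence the
Hessian stays invertible along the path, and by continuity it stays positive definite.
-/

open Filter Topology
open scoped Matrix

noncomputable section

namespace Bethe

section ExpIntegral

variable {X ι E : Type*} [Fintype ι] [NormedAddCommGroup E] [NormedSpace ℝ E]

/-- The dot product as a continuous bilinear map; `dotCLM η` is the linear functional `⟨η, ·⟩`, in
which form gradients are stated. -/
def dotCLM : (ι → ℝ) →L[ℝ] (ι → ℝ) →L[ℝ] ℝ :=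
  (dotProductBilin ℝ ℝ).toContinuousBilinearMap

@[simp]
theorem dotCLM_apply (v w : ι → ℝ) : dotCLM v w = v ⬝ᵥ w := rfl

theorem hasFDerivAt_exp_dotProduct (x θ : ι → ℝ) :
    HasFDerivAt (fun θ => Real.exp (θ ⬝ᵥ x)) (Real.exp (θ ⬝ᵥ x) • dotCLM x) θ := by
  simpa only [dotCLM_apply, dotProduct_comm x] using (dotCLM x).hasFDerivAt.exp (x := θ)

theorem abs_dotProduct_le (v w : ι → ℝ) : |v ⬝ᵥ w| ≤ ‖v‖ * ∑ a, |w a| := by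
  rw [dotProduct, Finset.mul_sum]
  refine (Finset.abs_sum_le_sum_abs _ _).trans (Finset.sum_le_sum fun a _ => ?_)
  rw [abs_mul]
  exact mul_le_mul_of_nonneg_right (norm_le_pi_norm v a) (abs_nonneg _)

theorem sign_dotProduct_self (x : ι → ℝ) : (fun a => (SignType.sign (x a) : ℝ)) ⬝ᵥ x = ∑ a, |x a| :=
  Finset.sum_congr rfl fun a _ => sign_mul_self (x a)

theorem norm_le_sum_abs (x : ι → ℝ) : ‖x‖ ≤ ∑ a, |x a| :=
  (pi_norm_le_iff_of_nonneg (Finset.sum_nonneg fun a _ => abs_nonneg (x a))).2 fun a =>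
    Finset.single_le_sum (f := fun a => |x a|) (fun _ _ => abs_nonneg _) (Finset.mem_univ a)

theorem norm_sign_le_one (s : ι → SignType) : ‖fun a => (s a : ℝ)‖ ≤ 1 :=
  (pi_norm_le_iff_of_nonneg zero_le_one).2 fun a => by cases s a <;> simp

-- Growing the parameter towards one of finitely many corners absorbs the factor `‖x‖`.
theorem exists_sign_exp_dotProduct_le {θ θ' : ι → ℝ} {δ : ℝ} (hδ : 0 ≤ δ) (h : ‖θ' - θ‖ ≤ δ)
    (x : ι → ℝ) : ∃ s : ι → SignType, Real.exp (θ' ⬝ᵥ x) * (δ * ‖x‖) ≤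
      Real.exp ((θ + (2 * δ) • fun a => (s a : ℝ)) ⬝ᵥ x) := by
  refine ⟨fun a => SignType.sign (x a), ?_⟩
  have hx : δ * ‖x‖ ≤ Real.exp (δ * ∑ a, |x a|) := by
    linarith [Real.add_one_le_exp (δ * ∑ a, |x a|),
      mul_le_mul_of_nonneg_left (norm_le_sum_abs x) hδ]
  have hθ : θ' ⬝ᵥ x ≤ θ ⬝ᵥ x + δ * ∑ a, |x a| := by
    rw [← sub_le_iff_le_add', ← sub_dotProduct]
    exact (le_abs_self _).trans <| (abs_dotProduct_le _ _).trans <|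
      mul_le_mul_of_nonneg_right h (Finset.sum_nonneg fun a _ => abs_nonneg (x a))
  calc Real.exp (θ' ⬝ᵥ x) * (δ * ‖x‖)
      ≤ Real.exp (θ ⬝ᵥ x + δ * ∑ a, |x a|) * Real.exp (δ * ∑ a, |x a|) := by gcongr
    _ = Real.exp ((θ + (2 * δ) • fun a => (SignType.sign (x a) : ℝ)) ⬝ᵥ x) := by
      rw [← Real.exp_add, add_dotProduct, smul_dotProduct, sign_dotProduct_self, smul_eq_mul]
      ring_nf

/-- The function `x ↦ (v ↦ ⟨φ x, v⟩ • g x)`: differentiating `∫ exp ⟨θ, φ⟩ • g dν` in `θ` replaces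
`g` by `smulStatistic φ g`. -/
def smulStatistic (φ : X → ι → ℝ) (g : X → E) (x : X) : (ι → ℝ) →L[ℝ] E :=
  (dotCLM (φ x)).smulRight (g x)

theorem norm_exp_smul_smulStatistic_le [DecidableEq ι] {θ θ' : ι → ℝ} {δ : ℝ}
    (hδ : 0 < δ) (h : ‖θ' - θ‖ ≤ δ) (φ : X → ι → ℝ) (g : X → E) (x : X) :
    ‖Real.exp (θ' ⬝ᵥ φ x) • smulStatistic φ g x‖ ≤
      ‖dotCLM (ι := ι)‖ * δ⁻¹ * ∑ s : ι → SignType,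
        ‖Real.exp ((θ + (2 * δ) • fun a => (s a : ℝ)) ⬝ᵥ φ x) • g x‖ := by
  obtain ⟨s, hs⟩ := exists_sign_exp_dotProduct_le hδ.le h (φ x)
  calc ‖Real.exp (θ' ⬝ᵥ φ x) • smulStatistic φ g x‖
      = Real.exp (θ' ⬝ᵥ φ x) * (‖dotCLM (φ x)‖ * ‖g x‖) := by
        rw [norm_smul, Real.norm_eq_abs, Real.abs_exp, smulStatistic,
          ContinuousLinearMap.norm_smulRight_apply]
    _ ≤ Real.exp (θ' ⬝ᵥ φ x) * (‖dotCLM (ι := ι)‖ * ‖φ x‖ * ‖g x‖) := by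
        gcongr
        exact dotCLM.le_opNorm (φ x)
    _ = ‖dotCLM (ι := ι)‖ * δ⁻¹ * (Real.exp (θ' ⬝ᵥ φ x) * (δ * ‖φ x‖) * ‖g x‖) := by
        field_simp
    _ ≤ ‖dotCLM (ι := ι)‖ * δ⁻¹ *
          (Real.exp ((θ + (2 * δ) • fun a => (s a : ℝ)) ⬝ᵥ φ x) * ‖g x‖) := by
        gcongr
    _ ≤ _ := by
        gcongr
        refine le_trans (le_of_eq ?_) (Finset.single_le_sum (f := fun s : ι → SignType =>
          ‖Real.exp ((θ + (2 * δ) • fun a => (s a : ℝ)) ⬝ᵥ φ x) • g x‖)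
          (fun _ _ => norm_nonneg _) (Finset.mem_univ s))
        rw [norm_smul, Real.norm_eq_abs, Real.abs_exp]

variable [MeasurableSpace X] {ν : Measure X} {φ : X → ι → ℝ} {g : X → E} {θ : ι → ℝ}

/-- The integral of `g` against the unnormalized density `exp ⟨θ, φ⟩`. Vector-valued `g` are allowed
so that the derivative in `θ` is an integral of the same kind. -/
def expIntegral (ν : Measure X) (φ : X → ι → ℝ) (g : X → E) (θ : ι → ℝ) : E :=
  ∫ x, Real.exp (θ ⬝ᵥ φ x) • g x ∂ν

theorem aestronglyMeasurable_exp_dotProduct (hφ : AEStronglyMeasurable φ ν) (θ : ι → ℝ) :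
    AEStronglyMeasurable (fun x => Real.exp (θ ⬝ᵥ φ x)) ν :=
  (Real.continuous_exp.comp (dotCLM θ).continuous).comp_aestronglyMeasurable hφ

theorem aestronglyMeasurable_smulStatistic (hφ : AEStronglyMeasurable φ ν)
    (hg : AEStronglyMeasurable g ν) : AEStronglyMeasurable (smulStatistic φ g) ν :=
  (ContinuousLinearMap.smulRightL ℝ (ι → ℝ) E).aestronglyMeasurable_comp₂
    (dotCLM.continuous.comp_aestronglyMeasurable hφ) hg

theorem exists_integrable_bound_smulStatistic
    (hint : ∀ᶠ θ' in 𝓝 θ, Integrable (fun x => Real.exp (θ' ⬝ᵥ φ x) • g x) ν) :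
    ∃ δ > 0, ∃ bound : X → ℝ, Integrable bound ν ∧ ∀ x, ∀ θ' ∈ Metric.ball θ δ,
      ‖Real.exp (θ' ⬝ᵥ φ x) • smulStatistic φ g x‖ ≤ bound x := by
  classical
  obtain ⟨ε, hε, hball⟩ := Metric.eventually_nhds_iff_ball.1 hint
  have hsign (s : ι → SignType) : θ + (2 * (ε / 3)) • (fun a => (s a : ℝ)) ∈ Metric.ball θ ε := by
    rw [mem_ball_iff_norm, add_sub_cancel_left, norm_smul, Real.norm_of_nonneg (by positivity)]
    linarith [mul_le_mul_of_nonneg_left (norm_sign_le_one s) (by positivity : 0 ≤ 2 * (ε / 3))]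
  exact ⟨ε / 3, by positivity, _,
    (integrable_finsetSum Finset.univ fun s _ => (hball _ (hsign s)).norm).const_mul _,
    fun x θ' hθ' =>
      norm_exp_smul_smulStatistic_le (by positivity) (mem_ball_iff_norm.1 hθ').le φ g x⟩

theorem integrable_exp_smul_smulStatistic (hφ : AEStronglyMeasurable φ ν)
    (hg : AEStronglyMeasurable g ν)
    (hint : ∀ᶠ θ' in 𝓝 θ, Integrable (fun x => Real.exp (θ' ⬝ᵥ φ x) • g x) ν) :
    Integrable (fun x => Real.exp (θ ⬝ᵥ φ x) • smulStatistic φ g x) ν := by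
  obtain ⟨δ, hδ, bound, hbound, hle⟩ := exists_integrable_bound_smulStatistic hint
  exact hbound.mono' ((aestronglyMeasurable_exp_dotProduct hφ θ).smul
    (aestronglyMeasurable_smulStatistic hφ hg))
    (.of_forall fun x => hle x θ (Metric.mem_ball_self hδ))

theorem hasFDerivAt_expIntegral (hφ : AEStronglyMeasurable φ ν) (hg : AEStronglyMeasurable g ν)
    (hint : ∀ᶠ θ' in 𝓝 θ, Integrable (fun x => Real.exp (θ' ⬝ᵥ φ x) • g x) ν) :
    HasFDerivAt (expIntegral ν φ g) (expIntegral ν φ (smulStatistic φ g) θ) θ := by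
  obtain ⟨δ, hδ, bound, hbound, hle⟩ := exists_integrable_bound_smulStatistic hint
  refine hasFDerivAt_integral_of_dominated_of_fderiv_le (Metric.ball_mem_nhds θ hδ)
    (.of_forall fun θ' => (aestronglyMeasurable_exp_dotProduct hφ θ').smul hg) hint.self_of_nhds
    (integrable_exp_smul_smulStatistic hφ hg hint).aestronglyMeasurable (.of_forall hle) hbound
    (.of_forall fun x θ' _ => ?_)
  refine ((hasFDerivAt_exp_dotProduct (φ x) θ').smul_const (g x)).congr_fderiv ?_
  ext v
  simp [smulStatistic, mul_smul]

theorem contDiffAt_expIntegral_one (hφ : AEStronglyMeasurable φ ν) (hg : AEStronglyMeasurable g ν)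
    (hint : ∀ᶠ θ' in 𝓝 θ, Integrable (fun x => Real.exp (θ' ⬝ᵥ φ x) • g x) ν) :
    ContDiffAt ℝ 1 (expIntegral ν φ g) θ := by
  refine contDiffAt_one_iff.2 ⟨expIntegral ν φ (smulStatistic φ g), _, hint.eventually_nhds,
    fun θ' hθ' => ?_, fun θ' hθ' => hasFDerivAt_expIntegral hφ hg hθ'⟩
  refine (hasFDerivAt_expIntegral hφ (aestronglyMeasurable_smulStatistic hφ hg)
    ?_).continuousAt.continuousWithinAt
  filter_upwards [eventually_eventually_nhds.2 hθ'] with θ'' hθ''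
  exact integrable_exp_smul_smulStatistic hφ hg hθ''

end ExpIntegral

section Covariance

variable {X ι κ : Type*} [MeasurableSpace X] {μ : Measure X} {f : X → ι → ℝ} {g : X → κ → ℝ}

theorem covMatrix_apply (a : ι) (b : κ) :
    covMatrix μ f g a b = cov[fun x => f x a, fun x => g x b; μ] := rfl

theorem transpose_covMatrix : (covMatrix μ f g)ᵀ = covMatrix μ g f := by
  ext a b
  exact covariance_comm _ _

variable [Fintype ι] [Fintype κ] [IsFiniteMeasure μ]

theorem covMatrix_mulVec_apply (hf : MemLp f 2 μ) (hg : MemLp g 2 μ) (v : κ → ℝ) (a : ι) :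
    (covMatrix μ f g *ᵥ v) a = cov[fun x => f x a, fun x => g x ⬝ᵥ v; μ] := by
  simp only [dotProduct, Matrix.mulVec]
  rw [covariance_fun_sum_right (fun b => (hg.eval b).mul_const (v b)) (hf.eval a)]
  simp only [covariance_mul_const_right, covMatrix_apply]

theorem dotProduct_covMatrix_mulVec (hf : MemLp f 2 μ) (hg : MemLp g 2 μ) (v : ι → ℝ) (w : κ → ℝ) :
    v ⬝ᵥ covMatrix μ f g *ᵥ w = cov[fun x => v ⬝ᵥ f x, fun x => g x ⬝ᵥ w; μ] := by
  have hgw : MemLp (fun x => g x ⬝ᵥ w) 2 μ :=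
    memLp_finsetSum _ fun b _ => (hg.eval b).mul_const (w b)
  change _ = cov[fun x => ∑ a, v a * f x a, fun x => g x ⬝ᵥ w; μ]
  rw [covariance_fun_sum_left (fun a => (hf.eval a).const_mul (v a)) hgw, dotProduct]
  simp only [covariance_const_mul_left, covMatrix_mulVec_apply hf hg]

theorem posSemidef_covMatrix (hf : MemLp f 2 μ) : (covMatrix μ f f).PosSemidef := by
  refine .of_dotProduct_mulVec_nonneg ?_ fun v => ?_
  · rw [Matrix.IsHermitian, Matrix.conjTranspose_eq_transpose_of_trivial, transpose_covMatrix]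
  · have hfv : AEMeasurable (fun x => f x ⬝ᵥ v) μ :=
      (memLp_finsetSum Finset.univ fun b _ =>
        (hf.eval b).mul_const (v b)).aestronglyMeasurable.aemeasurable
    rw [star_trivial, dotProduct_covMatrix_mulVec hf hf]
    simp only [dotProduct_comm v]
    rw [covariance_self hfv]
    exact variance_nonneg _ _

end Covariance

section ExponentialFamily

variable {X ι E : Type*} [MeasurableSpace X] [Fintype ι] [NormedAddCommGroup E] [NormedSpace ℝ E]
  {ν : Measure X} {φ : X → ι → ℝ} {θ : ι → ℝ}

theorem isOpen_naturalParams : IsOpen (naturalParams ν φ) := isOpen_interior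

theorem integrable_exp_dotProduct (hθ : θ ∈ naturalParams ν φ) :
    Integrable (fun x => Real.exp (θ ⬝ᵥ φ x)) ν :=
  interior_subset (s := {θ | Integrable (fun x => Real.exp (θ ⬝ᵥ φ x)) ν}) hθ

theorem convex_naturalParams (hφ : AEStronglyMeasurable φ ν) : Convex ℝ (naturalParams ν φ) := by
  refine Convex.interior fun θ₁ h₁ θ₂ h₂ s t hs ht hst => ?_
  refine ((Integrable.const_mul h₁ s).add (Integrable.const_mul h₂ t)).mono'
    (aestronglyMeasurable_exp_dotProduct hφ _) (.of_forall fun x => ?_)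
  rw [Real.norm_eq_abs, Real.abs_exp, add_dotProduct, smul_dotProduct, smul_dotProduct]
  exact convexOn_exp.2 (Set.mem_univ _) (Set.mem_univ _) hs ht hst

/-- The partition function `∫ exp ⟨θ, φ⟩ dν`. -/
def partition (ν : Measure X) (φ : X → ι → ℝ) : (ι → ℝ) → ℝ :=
  expIntegral ν φ fun _ => 1

theorem partition_eq (θ : ι → ℝ) : partition ν φ θ = ∫ x, Real.exp (θ ⬝ᵥ φ x) ∂ν := by
  simp only [partition, expIntegral, smul_eq_mul, mul_one]

theorem logPartition_eq (θ : ι → ℝ) : logPartition ν φ θ = Real.log (partition ν φ θ) := by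
  rw [logPartition, partition_eq]

theorem partition_pos [NeZero ν] (hθ : θ ∈ naturalParams ν φ) : 0 < partition ν φ θ := by
  rw [partition_eq]
  exact integral_exp_pos (integrable_exp_dotProduct hθ)

theorem expDist_eq_tilted (hθ : θ ∈ naturalParams ν φ) :
    expDist ν φ θ = ν.tilted fun x => θ ⬝ᵥ φ x := by
  rcases eq_zero_or_neZero ν with rfl | _
  · rw [tilted_zero_measure, expDist, withDensity_zero_left]
  · simp only [expDist, Measure.tilted, Real.exp_sub, logPartition_eq,
      Real.exp_log (partition_pos hθ)]
    rw [partition_eq]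

theorem isProbabilityMeasure_expDist [NeZero ν] (hθ : θ ∈ naturalParams ν φ) :
    IsProbabilityMeasure (expDist ν φ θ) := by
  rw [expDist_eq_tilted hθ]
  exact isProbabilityMeasure_tilted (integrable_exp_dotProduct hθ)

theorem integrable_expDist_iff (hθ : θ ∈ naturalParams ν φ) {g : X → E} :
    Integrable g (expDist ν φ θ) ↔ Integrable (fun x => Real.exp (θ ⬝ᵥ φ x) • g x) ν := by
  rw [expDist_eq_tilted hθ, integrable_tilted_iff (integrable_exp_dotProduct hθ)]

theorem integral_expDist (hθ : θ ∈ naturalParams ν φ) (g : X → E) :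
    ∫ x, g x ∂expDist ν φ θ = (partition ν φ θ)⁻¹ • expIntegral ν φ g θ := by
  rw [expDist_eq_tilted hθ, integral_tilted, partition_eq, expIntegral, ← integral_smul]
  simp only [smul_smul, div_eq_inv_mul]

theorem expIntegral_eq_smul_integral_expDist [NeZero ν] (hθ : θ ∈ naturalParams ν φ) (g : X → E) :
    expIntegral ν φ g θ = partition ν φ θ • ∫ x, g x ∂expDist ν φ θ := by
  rw [integral_expDist hθ, smul_inv_smul₀ (partition_pos hθ).ne']

theorem eventually_integrable_exp_smul_one (hθ : θ ∈ naturalParams ν φ) :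
    ∀ᶠ θ' in 𝓝 θ, Integrable (fun x => Real.exp (θ' ⬝ᵥ φ x) • (1 : ℝ)) ν := by
  filter_upwards [isOpen_naturalParams.mem_nhds hθ] with θ' hθ'
  simpa only [smul_eq_mul, mul_one] using integrable_exp_dotProduct hθ'

theorem integrable_exp_smul_statistic (hφ : AEStronglyMeasurable φ ν)
    (hθ : θ ∈ naturalParams ν φ) : Integrable (fun x => Real.exp (θ ⬝ᵥ φ x) • φ x) ν := by
  have h := integrable_exp_smul_smulStatistic hφ aestronglyMeasurable_const
    (eventually_integrable_exp_smul_one hθ)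
  classical
  refine Integrable.of_eval fun a => ?_
  simpa [smulStatistic] using h.apply_continuousLinearMap (Pi.single a 1)

theorem eventually_integrable_exp_smul_statistic (hφ : AEStronglyMeasurable φ ν)
    (hθ : θ ∈ naturalParams ν φ) :
    ∀ᶠ θ' in 𝓝 θ, Integrable (fun x => Real.exp (θ' ⬝ᵥ φ x) • φ x) ν := by
  filter_upwards [isOpen_naturalParams.mem_nhds hθ] with θ' hθ'
  exact integrable_exp_smul_statistic hφ hθ'

theorem integrable_smulStatistic_one (hφ : AEStronglyMeasurable φ ν)
    (hθ : θ ∈ naturalParams ν φ) :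
    Integrable (smulStatistic φ fun _ => (1 : ℝ)) (expDist ν φ θ) :=
  (integrable_expDist_iff hθ).2 <| integrable_exp_smul_smulStatistic hφ
    aestronglyMeasurable_const (eventually_integrable_exp_smul_one hθ)

theorem integrable_smulStatistic_self (hφ : AEStronglyMeasurable φ ν)
    (hθ : θ ∈ naturalParams ν φ) : Integrable (smulStatistic φ φ) (expDist ν φ θ) :=
  (integrable_expDist_iff hθ).2 <| integrable_exp_smul_smulStatistic hφ hφ
    (eventually_integrable_exp_smul_statistic hφ hθ)

theorem integrable_statistic (hφ : AEStronglyMeasurable φ ν) (hθ : θ ∈ naturalParams ν φ) :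
    Integrable φ (expDist ν φ θ) :=
  (integrable_expDist_iff hθ).2 (integrable_exp_smul_statistic hφ hθ)

theorem memLp_two_statistic (hφ : AEStronglyMeasurable φ ν) (hθ : θ ∈ naturalParams ν φ) :
    MemLp φ 2 (expDist ν φ θ) := by
  classical
  refine MemLp.of_eval fun a => (memLp_two_iff_integrable_sq
    ((integrable_statistic hφ hθ).eval a).aestronglyMeasurable).2 ?_
  simpa [smulStatistic, sq] using
    ((integrable_smulStatistic_self hφ hθ).apply_continuousLinearMap (Pi.single a 1)).eval a

theorem expectationMap_eq_integral (hφ : AEStronglyMeasurable φ ν) (hθ : θ ∈ naturalParams ν φ) :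
    expectationMap ν φ θ = ∫ x, φ x ∂expDist ν φ θ :=
  funext fun a => (eval_integral (fun b => (integrable_statistic hφ hθ).eval b) a).symm

theorem dotProduct_expectationMap (hφ : AEStronglyMeasurable φ ν) (hθ : θ ∈ naturalParams ν φ)
    (v : ι → ℝ) : v ⬝ᵥ expectationMap ν φ θ = ∫ x, v ⬝ᵥ φ x ∂expDist ν φ θ := by
  rw [expectationMap_eq_integral hφ hθ]
  exact ((dotCLM v).integral_comp_comm (integrable_statistic hφ hθ)).symm

theorem expectationMap_zero_measure : expectationMap (0 : Measure X) φ = 0 := by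
  ext
  simp [expectationMap, expDist]

theorem hasFDerivAt_partition [NeZero ν] (hφ : AEStronglyMeasurable φ ν)
    (hθ : θ ∈ naturalParams ν φ) :
    HasFDerivAt (partition ν φ) (partition ν φ θ • dotCLM (expectationMap ν φ θ)) θ := by
  refine (hasFDerivAt_expIntegral hφ aestronglyMeasurable_const
    (eventually_integrable_exp_smul_one hθ)).congr_fderiv ?_
  rw [expIntegral_eq_smul_integral_expDist hθ]
  congr 1
  ext v
  rw [ContinuousLinearMap.integral_apply (integrable_smulStatistic_one hφ hθ), dotCLM_apply,
    dotProduct_comm, dotProduct_expectationMap hφ hθ]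
  simp [smulStatistic, dotProduct_comm v]

theorem hasFDerivAt_logPartition (hφ : AEStronglyMeasurable φ ν) (hθ : θ ∈ naturalParams ν φ) :
    HasFDerivAt (logPartition ν φ) (dotCLM (expectationMap ν φ θ)) θ := by
  rcases eq_zero_or_neZero ν with rfl | _
  · have hψ : logPartition 0 φ = 0 := by ext; simp [logPartition]
    simpa [hψ, expectationMap_zero_measure] using hasFDerivAt_zero θ
  · have h := (hasFDerivAt_partition hφ hθ).log (partition_pos hθ).ne'
    rw [inv_smul_smul₀ (partition_pos hθ).ne'] at h
    simpa only [funext logPartition_eq] using h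

theorem expIntegral_smulStatistic_self_apply [NeZero ν] (hφ : AEStronglyMeasurable φ ν)
    (hθ : θ ∈ naturalParams ν φ) (v : ι → ℝ) (a : ι) :
    expIntegral ν φ (smulStatistic φ φ) θ v a =
      partition ν φ θ * ∫ x, φ x a * (φ x ⬝ᵥ v) ∂expDist ν φ θ := by
  have hint := integrable_smulStatistic_self hφ hθ
  rw [expIntegral_eq_smul_integral_expDist hθ, smul_apply, Pi.smul_apply,
    ContinuousLinearMap.integral_apply hint, smul_eq_mul,
    eval_integral fun b => (hint.apply_continuousLinearMap v).eval b]
  simp [smulStatistic, mul_comm]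

theorem covMatrix_expDist_mulVec_apply [NeZero ν] (hφ : AEStronglyMeasurable φ ν)
    (hθ : θ ∈ naturalParams ν φ) (v : ι → ℝ) (a : ι) :
    (covMatrix (expDist ν φ θ) φ φ *ᵥ v) a = ∫ x, φ x a * (φ x ⬝ᵥ v) ∂expDist ν φ θ -
      expectationMap ν φ θ a * (v ⬝ᵥ expectationMap ν φ θ) := by
  have := isProbabilityMeasure_expDist hθ
  have hL2 := memLp_two_statistic hφ hθ
  have hvL2 : MemLp (fun x => φ x ⬝ᵥ v) 2 (expDist ν φ θ) :=
    memLp_finsetSum _ fun b _ => (hL2.eval b).mul_const (v b)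
  rw [covMatrix_mulVec_apply hL2 hL2, covariance_eq_sub (hL2.eval a) hvL2,
    dotProduct_expectationMap hφ hθ]
  simp only [Pi.mul_apply, dotProduct_comm v, expectationMap]

theorem expectationMap_eventuallyEq (hφ : AEStronglyMeasurable φ ν)
    (hθ : θ ∈ naturalParams ν φ) :
    expectationMap ν φ =ᶠ[𝓝 θ] fun θ' => (partition ν φ θ')⁻¹ • expIntegral ν φ φ θ' := by
  filter_upwards [isOpen_naturalParams.mem_nhds hθ] with θ' hθ'
  rw [expectationMap_eq_integral hφ hθ', integral_expDist hθ']

theorem hasFDerivAt_expectationMap (hφ : AEStronglyMeasurable φ ν) (hθ : θ ∈ naturalParams ν φ) :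
    HasFDerivAt (expectationMap ν φ)
      (covMatrix (expDist ν φ θ) φ φ).mulVecLin.toContinuousLinearMap θ := by
  rcases eq_zero_or_neZero ν with rfl | _
  · have hcov : covMatrix (expDist 0 φ θ) φ φ = 0 := by
      ext
      simp [covMatrix_apply, covariance, expDist]
    simpa [expectationMap_zero_measure, hcov] using hasFDerivAt_const (𝕜 := ℝ) (0 : ι → ℝ) θ
  have hZ := (partition_pos hθ).ne'
  have hderiv := ((hasDerivAt_inv hZ).comp_hasFDerivAt θ (hasFDerivAt_partition hφ hθ)).smul
    (hasFDerivAt_expIntegral hφ hφ (eventually_integrable_exp_smul_statistic hφ hθ))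
  refine (hderiv.congr_of_eventuallyEq (expectationMap_eventuallyEq hφ hθ)).congr_fderiv ?_
  ext v a
  have hJ : expIntegral ν φ φ θ = partition ν φ θ • expectationMap ν φ θ := by
    rw [expectationMap_eq_integral hφ hθ, expIntegral_eq_smul_integral_expDist hθ]
  have hcov := covMatrix_expDist_mulVec_apply hφ hθ v a
  simp only [add_apply, smul_apply, ContinuousLinearMap.smulRight_apply, Pi.add_apply,
    Pi.smul_apply, Function.comp_apply, smul_eq_mul, dotCLM_apply,
    LinearMap.coe_toContinuousLinearMap', Matrix.mulVecLin_apply,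
    expIntegral_smulStatistic_self_apply hφ hθ, hcov, hJ, dotProduct_comm v]
  field_simp
  ring

theorem contDiffAt_expectationMap (hφ : AEStronglyMeasurable φ ν) (hθ : θ ∈ naturalParams ν φ) :
    ContDiffAt ℝ 1 (expectationMap ν φ) θ := by
  rcases eq_zero_or_neZero ν with rfl | _
  · rw [expectationMap_zero_measure]
    exact contDiffAt_const (c := 0)
  · exact (((contDiffAt_expIntegral_one hφ aestronglyMeasurable_const
      (eventually_integrable_exp_smul_one hθ)).inv (partition_pos hθ).ne').smul
      (contDiffAt_expIntegral_one hφ hφ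
        (eventually_integrable_exp_smul_statistic hφ hθ))).congr_of_eventuallyEq
      (expectationMap_eventuallyEq hφ hθ)

theorem logPartition_add_dotProduct_expectationMap_le (hφ : AEStronglyMeasurable φ ν)
    {θ₀ : ι → ℝ} (hθ₀ : θ₀ ∈ naturalParams ν φ) (hθ : θ ∈ naturalParams ν φ) :
    logPartition ν φ θ₀ + (θ - θ₀) ⬝ᵥ expectationMap ν φ θ₀ ≤ logPartition ν φ θ := by
  rcases eq_zero_or_neZero ν with rfl | _
  · simp [logPartition, expectationMap_zero_measure]
  have := isProbabilityMeasure_expDist hθ₀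
  have hexp : (fun x => θ₀ ⬝ᵥ φ x) + (fun x => (θ - θ₀) ⬝ᵥ φ x) = fun x => θ ⬝ᵥ φ x := by
    ext x
    rw [Pi.add_apply, ← add_dotProduct, add_sub_cancel]
  have hint : Integrable (fun x => Real.exp ((θ - θ₀) ⬝ᵥ φ x)) (expDist ν φ θ₀) := by
    refine (integrable_expDist_iff hθ₀).2 ?_
    simpa only [smul_eq_mul, ← Real.exp_add, ← add_dotProduct, add_sub_cancel]
      using integrable_exp_dotProduct hθ
  have hjensen : Real.exp ((θ - θ₀) ⬝ᵥ expectationMap ν φ θ₀) ≤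
      partition ν φ θ / partition ν φ θ₀ :=
    calc Real.exp ((θ - θ₀) ⬝ᵥ expectationMap ν φ θ₀)
        = Real.exp (∫ x, (θ - θ₀) ⬝ᵥ φ x ∂expDist ν φ θ₀) := by
          rw [dotProduct_expectationMap hφ hθ₀]
      _ ≤ ∫ x, Real.exp ((θ - θ₀) ⬝ᵥ φ x) ∂expDist ν φ θ₀ :=
          convexOn_exp.map_integral_le Real.continuous_exp.continuousOn isClosed_univ
            (.of_forall fun _ => Set.mem_univ _)
            ((dotCLM (θ - θ₀)).integrable_comp (integrable_statistic hφ hθ₀)) hint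
      _ = partition ν φ θ / partition ν φ θ₀ := by
          rw [expDist_eq_tilted hθ₀, integral_exp_tilted, hexp, partition_eq, partition_eq]
  rw [logPartition_eq, logPartition_eq, ← le_sub_iff_add_le',
    ← Real.log_div (partition_pos hθ).ne' (partition_pos hθ₀).ne']
  exact (Real.le_log_iff_exp_le (div_pos (partition_pos hθ) (partition_pos hθ₀))).2 hjensen

theorem legendre_expectationMap (hφ : AEStronglyMeasurable φ ν) (hθ : θ ∈ naturalParams ν φ) :
    legendre ν φ (expectationMap ν φ θ) =
      θ ⬝ᵥ expectationMap ν φ θ - logPartition ν φ θ := by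
  have : Nonempty (naturalParams ν φ) := ⟨⟨θ, hθ⟩⟩
  refine ciSup_eq_of_forall_le_of_forall_lt_exists_gt (fun θ' => ?_) fun w hw => ⟨⟨θ, hθ⟩, hw⟩
  have h := logPartition_add_dotProduct_expectationMap_le hφ hθ θ'.2
  rw [sub_dotProduct] at h
  linarith

end ExponentialFamily

section Hessian

variable {ι κ : Type*} [Fintype ι] [Fintype κ] {f g : (ι → ℝ) → ℝ} {x : ι → ℝ} {A B : Matrix ι ι ℝ}

/-- `f` is twice continuously differentiable at `x` with Hessian matrix `A`. Stated through a `C¹`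
gradient field of `f`, which makes sums and linear substitutions immediate. The transpose follows
the convention of `hessian`, whose row index is the variable of the second differentiation. -/
def HasHessianAt (f : (ι → ℝ) → ℝ) (A : Matrix ι ι ℝ) (x : ι → ℝ) : Prop :=
  ∃ f' : (ι → ℝ) → ι → ℝ, (∀ᶠ y in 𝓝 x, HasFDerivAt f (dotCLM (f' y)) y) ∧
    ContDiffAt ℝ 1 f' x ∧ HasFDerivAt f' Aᵀ.mulVecLin.toContinuousLinearMap x

theorem hasHessianAt_dotProduct (v x : ι → ℝ) : HasHessianAt (v ⬝ᵥ ·) 0 x :=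
  ⟨fun _ => v, .of_forall fun _ => (dotCLM v).hasFDerivAt, contDiffAt_const, by
    simpa using hasFDerivAt_const (𝕜 := ℝ) v x⟩

namespace HasHessianAt

theorem contDiffAt (h : HasHessianAt f A x) : ContDiffAt ℝ 2 f x := by
  obtain ⟨f', hf, hf', -⟩ := h
  obtain ⟨U, hU, hfU⟩ := eventually_iff_exists_mem.1 hf
  exact contDiffAt_succ_iff_hasFDerivAt.2
    ⟨fun y => dotCLM (f' y), ⟨U, hU, hfU⟩, (dotCLM (ι := ι)).contDiff.contDiffAt.comp x hf'⟩

theorem hessian_eq [DecidableEq ι] (h : HasHessianAt f A x) : hessian f x = A := by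
  obtain ⟨f', hf, -, hf'⟩ := h
  have hderiv : fderiv ℝ f =ᶠ[𝓝 x] fun y => dotCLM (f' y) := hf.mono fun y hy => hy.fderiv
  ext a b
  simp [hessian, ((dotCLM.hasFDerivAt.comp x hf').congr_of_eventuallyEq hderiv).fderiv]

theorem add (hf : HasHessianAt f A x) (hg : HasHessianAt g B x) :
    HasHessianAt (fun y => f y + g y) (A + B) x := by
  obtain ⟨f', hf, hf', hA⟩ := hf
  obtain ⟨g', hg, hg', hB⟩ := hg
  refine ⟨fun y => f' y + g' y, ?_, hf'.add hg', (hA.add hB).congr_fderiv ?_⟩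
  · filter_upwards [hf, hg] with y hfy hgy
    simpa only [map_add] using! hfy.add hgy
  · ext v : 1
    simp

theorem const_mul (c : ℝ) (hf : HasHessianAt f A x) :
    HasHessianAt (fun y => c * f y) (c • A) x := by
  obtain ⟨f', hf, hf', hA⟩ := hf
  refine ⟨fun y => c • f' y, ?_, hf'.const_smul c, (hA.const_smul c).congr_fderiv ?_⟩
  · filter_upwards [hf] with y hfy
    simpa only [map_smul] using hfy.const_mul c
  · ext v : 1
    simp

theorem comp_mulVec (M : Matrix ι κ ℝ) {x : κ → ℝ} (hf : HasHessianAt f A (M *ᵥ x)) :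
    HasHessianAt (fun y => f (M *ᵥ y)) (Mᵀ * A * M) x := by
  obtain ⟨f', hf, hf', hA⟩ := hf
  have hM (y : κ → ℝ) : HasFDerivAt (M *ᵥ ·) M.mulVecLin.toContinuousLinearMap y :=
    M.mulVecLin.toContinuousLinearMap.hasFDerivAt
  have hMt (y : ι → ℝ) : HasFDerivAt (Mᵀ *ᵥ ·) Mᵀ.mulVecLin.toContinuousLinearMap y :=
    Mᵀ.mulVecLin.toContinuousLinearMap.hasFDerivAt
  refine ⟨fun y => Mᵀ *ᵥ f' (M *ᵥ y), ?_,
    Mᵀ.mulVecLin.toContinuousLinearMap.contDiff.contDiffAt.comp x <|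
      hf'.comp x M.mulVecLin.toContinuousLinearMap.contDiff.contDiffAt,
    ((hMt _).comp x (hA.comp x (hM x))).congr_fderiv ?_⟩
  · filter_upwards [(hM x).continuousAt.eventually hf] with y hy
    refine (hy.comp y (hM y)).congr_fderiv ?_
    ext v
    simp [Matrix.mulVec_transpose, Matrix.dotProduct_mulVec]
  · ext v : 1
    simp [Matrix.transpose_mul, Matrix.mul_assoc]

theorem sum {σ : Type*} (s : Finset σ) {f : σ → (ι → ℝ) → ℝ} {A : σ → Matrix ι ι ℝ}
    (hf : ∀ i ∈ s, HasHessianAt (f i) (A i) x) :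
    HasHessianAt (fun y => ∑ i ∈ s, f i y) (∑ i ∈ s, A i) x := by
  classical
  induction s using Finset.induction_on with
  | empty => simpa using hasHessianAt_dotProduct 0 x
  | insert i s hi ih =>
    simp only [Finset.sum_insert hi]
    exact (hf i (s.mem_insert_self i)).add (ih fun j hj => hf j (Finset.mem_insert_of_mem hj))

end HasHessianAt

end Hessian

section InverseFunction

variable {ι : Type*} [Fintype ι] {A : Matrix ι ι ℝ}

theorem exists_continuousLinearEquiv_eq_mulVec [DecidableEq ι] (hA : IsUnit A) :
    ∃ e : (ι → ℝ) ≃L[ℝ] (ι → ℝ), (e : (ι → ℝ) →L[ℝ] ι → ℝ) = A.mulVecLin.toContinuousLinearMap ∧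
      (e.symm : (ι → ℝ) →L[ℝ] ι → ℝ) = A⁻¹.mulVecLin.toContinuousLinearMap := by
  rw [Matrix.isUnit_iff_isUnit_det] at hA
  refine ⟨.equivOfInverse A.mulVecLin.toContinuousLinearMap A⁻¹.mulVecLin.toContinuousLinearMap
    (fun v => ?_) (fun v => ?_), rfl, rfl⟩
  · simp [Matrix.nonsing_inv_mul A hA]
  · simp [Matrix.mul_nonsing_inv A hA]

theorem injOn_of_posDef_hasFDerivAt {f : (ι → ℝ) → ι → ℝ} {f' : (ι → ℝ) → Matrix ι ι ℝ}
    {s : Set (ι → ℝ)} (hs : Convex ℝ s)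
    (hf : ∀ x ∈ s, HasFDerivAt f (f' x).mulVecLin.toContinuousLinearMap x)
    (hf' : ∀ x ∈ s, (f' x).PosDef) : Set.InjOn f s := by
  intro x hx y hy hxy
  by_contra hne
  let γ : ℝ → ι → ℝ := AffineMap.lineMap x y
  have hγ : ∀ t ∈ Set.Icc (0 : ℝ) 1, γ t ∈ s := fun t ht => hs.lineMap_mem hx hy ht
  have hderiv : ∀ t ∈ Set.Icc (0 : ℝ) 1,
      HasDerivAt (fun t => (y - x) ⬝ᵥ f (γ t)) ((y - x) ⬝ᵥ f' (γ t) *ᵥ (y - x)) t := fun t ht =>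
    (dotCLM (y - x)).hasFDerivAt.comp_hasDerivAt t
      ((hf _ (hγ t ht)).comp_hasDerivAt t AffineMap.hasDerivAt_lineMap)
  obtain ⟨t, ht, hzero⟩ := exists_hasDerivAt_eq_zero zero_lt_one
    (fun t ht => (hderiv t ht).continuousAt.continuousWithinAt) (by simp [γ, hxy])
    fun t ht => hderiv t (Set.Ioo_subset_Icc_self ht)
  have hpos := (hf' _ (hγ t (Set.Ioo_subset_Icc_self ht))).dotProduct_mulVec_pos
    (sub_ne_zero.2 (Ne.symm hne))
  exact hpos.ne' (by simpa using hzero)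

section

variable {E F : Type*} [NormedAddCommGroup E] [NormedSpace ℝ E] [CompleteSpace E]
  [NormedAddCommGroup F] [NormedSpace ℝ F] {f : E → F} {s : Set E} {x : E} {e : E ≃L[ℝ] F}

theorem image_mem_nhds_of_contDiffAt (hs : s ∈ 𝓝 x) (hf : ContDiffAt ℝ 1 f x)
    (hf' : HasFDerivAt f (e : E →L[ℝ] F) x) : f '' s ∈ 𝓝 (f x) :=
  (hf.hasStrictFDerivAt' hf' one_ne_zero).map_nhds_eq_of_equiv ▸ image_mem_map hs

theorem contDiffAt_of_eventually_leftInverse {g : F → E} (hg : ∀ᶠ y in 𝓝 x, g (f y) = y)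
    (hf : ContDiffAt ℝ 1 f x) (hf' : HasFDerivAt f (e : E →L[ℝ] F) x) :
    ContDiffAt ℝ 1 g (f x) :=
  (hf.to_localInverse hf' one_ne_zero).congr_of_eventuallyEq
    ((hf.hasStrictFDerivAt' hf' one_ne_zero).localInverse_unique hg)

theorem hasFDerivAt_of_eventually_leftInverse {g : F → E} (hg : ∀ᶠ y in 𝓝 x, g (f y) = y)
    (hf : ContDiffAt ℝ 1 f x) (hf' : HasFDerivAt f (e : E →L[ℝ] F) x) :
    HasFDerivAt g (e.symm : F →L[ℝ] E) (f x) :=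
  ((hf.hasStrictFDerivAt' hf' one_ne_zero).to_local_left_inverse hg).hasFDerivAt

end

end InverseFunction

section RegularFamily

variable {X ι : Type*} [MeasurableSpace X] [Fintype ι] {ν : Measure X} {φ : X → ι → ℝ}
  {η θ : ι → ℝ}

/-- An exponential family whose expectation parameters can serve as coordinates: the log partition
function has an invertible Hessian at every natural parameter. -/
structure IsRegularFamily [DecidableEq ι] (ν : Measure X) (φ : X → ι → ℝ) : Prop where
  aestronglyMeasurable : AEStronglyMeasurable φ ν
  isUnit_hessian : ∀ θ ∈ naturalParams ν φ, IsUnit (hessian (logPartition ν φ) θ)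

/-- The natural parameter of the member of the family with expectation parameter `η`, that is, the
inverse of `Λ` on `Y`. -/
def naturalParam (ν : Measure X) (φ : X → ι → ℝ) : (ι → ℝ) → ι → ℝ :=
  Function.invFunOn (expectationMap ν φ) (naturalParams ν φ)

theorem naturalParam_mem (hη : η ∈ expectationParams ν φ) :
    naturalParam ν φ η ∈ naturalParams ν φ :=
  Function.invFunOn_mem hη

theorem expectationMap_naturalParam (hη : η ∈ expectationParams ν φ) :
    expectationMap ν φ (naturalParam ν φ η) = η :=
  Function.invFunOn_eq hη

theorem hasHessianAt_logPartition (hφ : AEStronglyMeasurable φ ν) (hθ : θ ∈ naturalParams ν φ) :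
    HasHessianAt (logPartition ν φ) (covMatrix (expDist ν φ θ) φ φ) θ :=
  ⟨expectationMap ν φ, (isOpen_naturalParams.eventually_mem hθ).mono fun _ =>
    hasFDerivAt_logPartition hφ, contDiffAt_expectationMap hφ hθ,
    transpose_covMatrix (f := φ) ▸ hasFDerivAt_expectationMap hφ hθ⟩

theorem isFiniteMeasure_expDist (hθ : θ ∈ naturalParams ν φ) : IsFiniteMeasure (expDist ν φ θ) := by
  rw [expDist_eq_tilted hθ]
  infer_instance

namespace IsRegularFamily

variable [DecidableEq ι]

theorem posDef_covMatrix (h : IsRegularFamily ν φ) (hθ : θ ∈ naturalParams ν φ) :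
    (covMatrix (expDist ν φ θ) φ φ).PosDef := by
  have := isFiniteMeasure_expDist hθ
  rw [(posSemidef_covMatrix (memLp_two_statistic h.aestronglyMeasurable hθ)).posDef_iff_isUnit,
    ← (hasHessianAt_logPartition h.aestronglyMeasurable hθ).hessian_eq]
  exact h.isUnit_hessian θ hθ

theorem injOn_expectationMap (h : IsRegularFamily ν φ) :
    Set.InjOn (expectationMap ν φ) (naturalParams ν φ) :=
  injOn_of_posDef_hasFDerivAt (convex_naturalParams h.aestronglyMeasurable)
    (fun _ hθ => hasFDerivAt_expectationMap h.aestronglyMeasurable hθ)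
    fun _ hθ => h.posDef_covMatrix hθ

theorem naturalParam_expectationMap (h : IsRegularFamily ν φ) (hθ : θ ∈ naturalParams ν φ) :
    naturalParam ν φ (expectationMap ν φ θ) = θ :=
  h.injOn_expectationMap.leftInvOn_invFunOn hθ

theorem posDef_covMatrix_distOfMean (h : IsRegularFamily ν φ) (hη : η ∈ expectationParams ν φ) :
    (covMatrix (distOfMean ν φ η) φ φ).PosDef :=
  h.posDef_covMatrix (naturalParam_mem hη)

theorem isOpen_expectationParams (h : IsRegularFamily ν φ) : IsOpen (expectationParams ν φ) := by
  refine isOpen_iff_mem_nhds.2 ?_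
  rintro _ ⟨θ, hθ, rfl⟩
  obtain ⟨e, he, -⟩ := exists_continuousLinearEquiv_eq_mulVec (h.posDef_covMatrix hθ).isUnit
  exact image_mem_nhds_of_contDiffAt (isOpen_naturalParams.mem_nhds hθ)
    (contDiffAt_expectationMap h.aestronglyMeasurable hθ)
    (he ▸ hasFDerivAt_expectationMap h.aestronglyMeasurable hθ)

theorem contDiffAt_hasFDerivAt_naturalParam (h : IsRegularFamily ν φ)
    (hη : η ∈ expectationParams ν φ) :
    ContDiffAt ℝ 1 (naturalParam ν φ) η ∧ HasFDerivAt (naturalParam ν φ)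
      (covMatrix (distOfMean ν φ η) φ φ)⁻¹.mulVecLin.toContinuousLinearMap η := by
  have hθ := naturalParam_mem hη
  obtain ⟨e, he, he'⟩ := exists_continuousLinearEquiv_eq_mulVec (h.posDef_covMatrix hθ).isUnit
  have hleft : ∀ᶠ θ in 𝓝 (naturalParam ν φ η), naturalParam ν φ (expectationMap ν φ θ) = θ :=
    (isOpen_naturalParams.eventually_mem hθ).mono fun _ => h.naturalParam_expectationMap
  have hC := contDiffAt_expectationMap h.aestronglyMeasurable hθ
  have hD := he ▸ hasFDerivAt_expectationMap h.aestronglyMeasurable hθ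
  have hC' := contDiffAt_of_eventually_leftInverse hleft hC hD
  have hD' := hasFDerivAt_of_eventually_leftInverse hleft hC hD
  rw [expectationMap_naturalParam hη] at hC' hD'
  exact ⟨hC', he' ▸ hD'⟩

theorem hasFDerivAt_legendre (h : IsRegularFamily ν φ) (hη : η ∈ expectationParams ν φ) :
    HasFDerivAt (legendre ν φ) (dotCLM (naturalParam ν φ η)) η := by
  have hθ := naturalParam_mem hη
  have hinv := (h.contDiffAt_hasFDerivAt_naturalParam hη).2
  have heq : legendre ν φ =ᶠ[𝓝 η] fun y =>
      dotCLM (naturalParam ν φ y) y - logPartition ν φ (naturalParam ν φ y) := by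
    filter_upwards [h.isOpen_expectationParams.mem_nhds hη] with y hy
    have := legendre_expectationMap h.aestronglyMeasurable (naturalParam_mem hy)
    rwa [expectationMap_naturalParam hy] at this
  have hpair := ((dotCLM (ι := ι)).hasFDerivAt.comp η hinv).clm_apply (hasFDerivAt_id η)
  have hψ := (hasFDerivAt_logPartition h.aestronglyMeasurable hθ).comp η hinv
  refine ((hpair.sub hψ).congr_of_eventuallyEq heq).congr_fderiv ?_
  ext v
  simp [expectationMap_naturalParam hη, dotProduct_comm]

theorem hasHessianAt_legendre (h : IsRegularFamily ν φ) (hη : η ∈ expectationParams ν φ) :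
    HasHessianAt (legendre ν φ) (covMatrix (distOfMean ν φ η) φ φ)⁻¹ η := by
  obtain ⟨hC, hD⟩ := h.contDiffAt_hasFDerivAt_naturalParam hη
  refine ⟨naturalParam ν φ, ?_, hC, ?_⟩
  · exact (h.isOpen_expectationParams.eventually_mem hη).mono fun _ => h.hasFDerivAt_legendre
  · rwa [Matrix.transpose_nonsing_inv, transpose_covMatrix]

end IsRegularFamily

end RegularFamily

section PosDef

variable {m n : Type*}

theorem eventually_posDef [Finite n] {A : Matrix n n ℝ} (hA : A.PosDef) :
    ∀ᶠ B in 𝓝 A, B.IsHermitian → B.PosDef := by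
  have := Fintype.ofFinite n
  have hpos : ∀ᶠ B in 𝓝 A, ∀ x ∈ Metric.sphere (0 : n → ℝ) 1, 0 < x ⬝ᵥ B *ᵥ x := by
    refine (isCompact_sphere (0 : n → ℝ) 1).eventually_forall_of_forall_eventually fun x hx => ?_
    have hcont : Continuous fun z : Matrix n n ℝ × (n → ℝ) => z.2 ⬝ᵥ z.1 *ᵥ z.2 := by fun_prop
    exact hcont.continuousAt.eventually <| lt_mem_nhds <|
      hA.dotProduct_mulVec_pos (ne_zero_of_mem_unit_sphere ⟨x, hx⟩)
  filter_upwards [hpos] with B hB hherm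
  refine .of_dotProduct_mulVec_pos hherm fun {x} hx => ?_
  have hx' : 0 < ‖x‖ := norm_pos_iff.2 hx
  have h := hB (‖x‖⁻¹ • x) (by simp [norm_smul, hx'.ne'])
  rw [Matrix.mulVec_smul, smul_dotProduct, dotProduct_smul, smul_eq_mul, smul_eq_mul] at h
  exact pos_of_mul_pos_right (pos_of_mul_pos_right h (by positivity)) (by positivity)

theorem isClosed_setOf_posSemidef [Finite n] : IsClosed {A : Matrix n n ℝ | A.PosSemidef} := by
  have := Fintype.ofFinite n
  simp only [Matrix.posSemidef_iff_dotProduct_mulVec, Set.ofPred_and, Set.ofPred_forall]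
  exact (isClosed_eq (by fun_prop) continuous_id).inter
    (isClosed_iInter fun x => isClosed_le continuous_const (by fun_prop))

theorem posDef_of_continuous_of_isUnit {T : Type*} [TopologicalSpace T] [PreconnectedSpace T]
    [Fintype n] [DecidableEq n] {A : T → Matrix n n ℝ} (hA : Continuous A)
    (hherm : ∀ t, (A t).IsHermitian) (hunit : ∀ t, IsUnit (A t)) {t₀ : T} (h₀ : (A t₀).PosDef)
    (t : T) : (A t).PosDef := by
  have hclosed : IsClosed {t | (A t).PosDef} := by
    have h : {t | (A t).PosDef} = A ⁻¹' {A | A.PosSemidef} := by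
      ext t
      exact ⟨fun h => h.posSemidef, fun h => h.posDef_iff_isUnit.2 (hunit t)⟩
    rw [h]
    exact isClosed_setOf_posSemidef.preimage hA
  have hopen : IsOpen {t | (A t).PosDef} := isOpen_iff_mem_nhds.2 fun t ht =>
    (hA.continuousAt.eventually (eventually_posDef ht)).mono fun t' h => h (hherm t')
  have huniv := IsClopen.eq_univ ⟨hclosed, hopen⟩ ⟨t₀, h₀⟩
  exact huniv.ge (Set.mem_univ t)

theorem posDef_fromBlocks_zero [Finite m] [Finite n] {A : Matrix m m ℝ} {D : Matrix n n ℝ}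
    (hA : A.PosDef) (hD : D.PosDef) : (Matrix.fromBlocks A 0 0 D).PosDef := by
  have := Fintype.ofFinite m
  have := Fintype.ofFinite n
  refine .of_dotProduct_mulVec_pos
    (hA.isHermitian.fromBlocks (Matrix.conjTranspose_zero) hD.isHermitian) fun {x} hx => ?_
  obtain ⟨u, v, rfl⟩ : ∃ u v, x = Sum.elim u v := ⟨_, _, (Sum.elim_comp_inl_inr x).symm⟩
  have hu := hA.posSemidef.dotProduct_mulVec_nonneg u
  have hv := hD.posSemidef.dotProduct_mulVec_nonneg v
  simp only [Matrix.fromBlocks_mulVec, Function.star_sumElim, sumElim_dotProduct_sumElim,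
    Sum.elim_comp_inl, Sum.elim_comp_inr, Matrix.zero_mulVec, add_zero, zero_add]
  rcases eq_or_ne u 0 with rfl | hu0
  · have hv0 : v ≠ 0 := by
      rintro rfl
      exact hx (by ext (_ | _) <;> rfl)
    exact add_pos_of_nonneg_of_pos hu (hD.dotProduct_mulVec_pos hv0)
  · exact add_pos_of_pos_of_nonneg (hA.dotProduct_mulVec_pos hu0) hv

theorem continuous_inv_of_isUnit {T : Type*} [TopologicalSpace T] [Fintype n] [DecidableEq n]
    {A : T → Matrix n n ℝ} (hA : Continuous A) (hunit : ∀ t, IsUnit (A t)) :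
    Continuous fun t => (A t)⁻¹ :=
  continuous_iff_continuousAt.2 fun t => by
    obtain ⟨d, hd⟩ := (Matrix.isUnit_iff_isUnit_det _).1 (hunit t)
    exact (continuousAt_matrix_inv _ (hd ▸ NormedRing.inverse_continuousAt d)).comp hA.continuousAt

end PosDef

section BetheHessian

variable {N P Q : Type*} [Fintype N] [Fintype Q] [DecidableEq N]

variable (N) in
/-- The passage from the coordinates `η` to the coordinates `η_α` of all factors: the `N`-part (the
`η_⟨α⟩`) is kept and the `Q`-part (the `η_i`) is copied by `T` to the directed edges, whose
coordinates form `P`. -/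
def gluing (T : Matrix P Q ℝ) : Matrix (N ⊕ P) (N ⊕ Q) ℝ :=
  Matrix.fromBlocks 1 0 0 T

theorem gluing_mulVec (T : Matrix P Q ℝ) (x : N ⊕ Q → ℝ) :
    gluing N T *ᵥ x = Sum.elim (x ∘ Sum.inl) (T *ᵥ (x ∘ Sum.inr)) := by
  simp [gluing, Matrix.fromBlocks_mulVec]

variable [Fintype P] [DecidableEq P]

theorem inv_mulVec_mulVec {A : Matrix P P ℝ} (hA : IsUnit A) (v : P → ℝ) : A⁻¹ *ᵥ A *ᵥ v = v := by
  rw [Matrix.isUnit_iff_isUnit_det] at hA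
  rw [Matrix.mulVec_mulVec, Matrix.nonsing_inv_mul A hA, Matrix.one_mulVec]

/-- The edge matrix `M(u)` expressed through the copies `T` of the vertex coordinates along the
edges, the covariances `K` of these copies within each hyperedge, and the diagonal blocks `B` of
`K`: the factor `T * Tᵀ - 1` passes from an edge to the other edges at its vertex, the factor
`B⁻¹ * (K - B)` from an edge to the other edges of its hyperedge. -/
def edgeOperator (T : Matrix P Q ℝ) (K B : Matrix P P ℝ) : Matrix P P ℝ :=
  B⁻¹ * (K - B) * (T * Tᵀ - 1)

theorem edgeOperator_mulVec_eq_self {T : Matrix P Q ℝ} {K B : Matrix P P ℝ} (hB : IsUnit B)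
    {y : P → ℝ} {z : Q → ℝ} (hz : Tᵀ *ᵥ (T *ᵥ z - y) = z) (hy : K *ᵥ y = B *ᵥ T *ᵥ z) :
    edgeOperator T K B *ᵥ (T *ᵥ z - y) = T *ᵥ z - y := by
  have hstep : (T * Tᵀ - 1) *ᵥ (T *ᵥ z - y) = y := by
    rw [Matrix.sub_mulVec, ← Matrix.mulVec_mulVec, hz, Matrix.one_mulVec, sub_sub_cancel]
  rw [edgeOperator, ← Matrix.mulVec_mulVec, hstep, ← Matrix.mulVec_mulVec, Matrix.sub_mulVec, hy,
    ← Matrix.mulVec_sub, inv_mulVec_mulVec hB]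

theorem edgeOperator_interpolate (T : Matrix P Q ℝ) (K B : Matrix P P ℝ) (t : ℝ) :
    edgeOperator T (t • K + (1 - t) • B) B = t • edgeOperator T K B := by
  have hsub : t • K + (1 - t) • B - B = t • (K - B) := by module
  rw [edgeOperator, hsub, edgeOperator, Matrix.mul_smul, Matrix.smul_mul]

variable [DecidableEq Q]

/-- The Hessian of the Bethe free energy, as a function of the covariances: `C` collects all factor
covariances, `W` the vertex variances, and `B` the copies of the latter along the edges. -/
def betheHessian (T : Matrix P Q ℝ) (C : Matrix (N ⊕ P) (N ⊕ P) ℝ) (B : Matrix P P ℝ)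
    (W : Matrix Q Q ℝ) : Matrix (N ⊕ Q) (N ⊕ Q) ℝ :=
  (gluing N T)ᵀ * C⁻¹ * gluing N T + Matrix.fromBlocks 0 0 0 (W⁻¹ - Tᵀ * B⁻¹ * T)

variable {T : Matrix P Q ℝ} {C : Matrix (N ⊕ P) (N ⊕ P) ℝ} {B : Matrix P P ℝ} {W : Matrix Q Q ℝ}

theorem isHermitian_betheHessian (hC : C.IsHermitian) (hB : B.IsHermitian) (hW : W.IsHermitian) :
    (betheHessian T C B W).IsHermitian := by
  have hTB : (Tᵀ * B⁻¹ * T).IsHermitian := Matrix.isHermitian_conjTranspose_mul_mul T hB.inv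
  have hTC : ((gluing N T)ᵀ * C⁻¹ * gluing N T).IsHermitian :=
    Matrix.isHermitian_conjTranspose_mul_mul _ hC.inv
  exact hTC.add (Matrix.isHermitian_zero.fromBlocks Matrix.conjTranspose_zero (hW.inv.sub hTB))

theorem betheHessian_fromBlocks (hB : IsUnit B) :
    betheHessian T (Matrix.fromBlocks (1 : Matrix N N ℝ) 0 0 B) B W =
      Matrix.fromBlocks 1 0 0 W⁻¹ := by
  rw [Matrix.isUnit_iff_isUnit_det] at hB
  have hinv : (Matrix.fromBlocks (1 : Matrix N N ℝ) 0 0 B)⁻¹ = Matrix.fromBlocks 1 0 0 B⁻¹ :=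
    Matrix.inv_eq_right_inv (by simp [Matrix.fromBlocks_multiply, Matrix.mul_nonsing_inv B hB])
  simp [betheHessian, gluing, hinv, Matrix.fromBlocks_transpose, Matrix.fromBlocks_multiply,
    Matrix.fromBlocks_add]

theorem betheHessian_mulVec (x : N ⊕ Q → ℝ) :
    betheHessian T C B W *ᵥ x = (gluing N T)ᵀ *ᵥ C⁻¹ *ᵥ gluing N T *ᵥ x +
      Sum.elim (0 : N → ℝ) (W⁻¹ *ᵥ (x ∘ Sum.inr) - Tᵀ *ᵥ B⁻¹ *ᵥ T *ᵥ (x ∘ Sum.inr)) := by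
  simp only [betheHessian, Matrix.add_mulVec, Matrix.fromBlocks_mulVec, Matrix.sub_mulVec,
    ← Matrix.mulVec_mulVec, Matrix.zero_mulVec, zero_add, add_zero]

theorem eq_zero_of_betheHessian_mulVec_eq_zero (hC : IsUnit C) (hB : IsUnit B) (hW : IsUnit W)
    (hBT : B * T = T * W) (hM : ∀ f, edgeOperator T C.toBlocks₂₂ B *ᵥ f = f → f = 0)
    {x : N ⊕ Q → ℝ} (hx : betheHessian T C B W *ᵥ x = 0) : x = 0 := by
  obtain ⟨y, hy⟩ : ∃ y, C *ᵥ y = gluing N T *ᵥ x := Matrix.mulVec_surjective_iff_isUnit.2 hC _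
  obtain ⟨z, hz⟩ : ∃ z, W *ᵥ z = x ∘ Sum.inr := Matrix.mulVec_surjective_iff_isUnit.2 hW _
  have hTz : T *ᵥ (x ∘ Sum.inr) = B *ᵥ T *ᵥ z := by
    rw [← hz, Matrix.mulVec_mulVec, ← hBT, Matrix.mulVec_mulVec]
  obtain ⟨hy₁, hy₂⟩ : y ∘ Sum.inl = 0 ∧ Tᵀ *ᵥ (y ∘ Sum.inr) + (z - Tᵀ *ᵥ T *ᵥ z) = 0 := by
    rw [betheHessian_mulVec, ← hy, inv_mulVec_mulVec hC, hTz, inv_mulVec_mulVec hB, ← hz,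
      inv_mulVec_mulVec hW, gluing, Matrix.fromBlocks_transpose, Matrix.fromBlocks_mulVec,
      ← Sum.elim_add_add] at hx
    simpa [← Sum.elim_zero_zero, Sum.elim_eq_iff] using hx
  have hCy : C.toBlocks₂₂ *ᵥ (y ∘ Sum.inr) = B *ᵥ T *ᵥ z := by
    rw [← C.fromBlocks_toBlocks, Matrix.fromBlocks_mulVec, gluing_mulVec, hTz, hy₁] at hy
    simpa using congrArg (· ∘ Sum.inr) hy
  have hf : Tᵀ *ᵥ (T *ᵥ z - y ∘ Sum.inr) = z := by
    rw [Matrix.mulVec_sub]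
    linear_combination (exp := 1) -hy₂
  have hf0 := hM _ (edgeOperator_mulVec_eq_self hB hf hCy)
  have hz0 : z = 0 := by rw [← hf, hf0, Matrix.mulVec_zero]
  have hy0 : y = 0 := by
    rw [hz0, Matrix.mulVec_zero, zero_sub, neg_eq_zero] at hf0
    rw [← Sum.elim_comp_inl_inr y, hy₁, hf0, Sum.elim_zero_zero]
  rw [hy0, Matrix.mulVec_zero, gluing_mulVec] at hy
  have hx₁ : x ∘ Sum.inl = 0 := by simpa using (congrArg (· ∘ Sum.inl) hy).symm
  rw [← Sum.elim_comp_inl_inr x, hx₁, ← hz, hz0, Matrix.mulVec_zero, Sum.elim_zero_zero]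

theorem isUnit_betheHessian (hC : IsUnit C) (hB : IsUnit B) (hW : IsUnit W)
    (hBT : B * T = T * W) (hM : ∀ f, edgeOperator T C.toBlocks₂₂ B *ᵥ f = f → f = 0) :
    IsUnit (betheHessian T C B W) :=
  Matrix.mulVec_injective_iff_isUnit.1 <| (injective_iff_map_eq_zero
    (betheHessian T C B W).mulVecLin).2 fun _ =>
      eq_zero_of_betheHessian_mulVec_eq_zero hC hB hW hBT hM

theorem posDef_betheHessian (hC : C.PosDef) (hB : B.PosDef) (hW : W.PosDef) (hBT : B * T = T * W)
    (hM : ∀ c : ℝ, 1 ≤ c → ∀ f, edgeOperator T C.toBlocks₂₂ B *ᵥ f = c • f → f = 0) :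
    (betheHessian T C B W).PosDef := by
  -- Interpolate between the covariances and those of independent vertices.
  let Ct (t : unitInterval) : Matrix (N ⊕ P) (N ⊕ P) ℝ :=
    (t : ℝ) • C + (1 - t : ℝ) • Matrix.fromBlocks 1 0 0 B
  have hCt (t : unitInterval) : (Ct t).PosDef := by
    have hD : (Matrix.fromBlocks (1 : Matrix N N ℝ) 0 0 B).PosDef := posDef_fromBlocks_zero .one hB
    rcases t.2.1.eq_or_lt with ht | ht
    · simpa [Ct, ← ht] using hD
    · exact (hC.smul ht).add_posSemidef (hD.posSemidef.smul (sub_nonneg.2 t.2.2))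
  have hcont : Continuous Ct := by fun_prop
  have hfix (t : unitInterval) (f : P → ℝ) (hf : edgeOperator T (Ct t).toBlocks₂₂ B *ᵥ f = f) :
      f = 0 := by
    have hCt₂₂ : (Ct t).toBlocks₂₂ = (t : ℝ) • C.toBlocks₂₂ + (1 - t : ℝ) • B := rfl
    rw [hCt₂₂, edgeOperator_interpolate, Matrix.smul_mulVec] at hf
    rcases t.2.1.eq_or_lt with ht | ht
    · rw [← hf, ← ht, zero_smul]
    · exact hM _ ((one_le_inv₀ ht).2 t.2.2) f ((eq_inv_smul_iff₀ ht.ne').2 hf)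
  have hpos := posDef_of_continuous_of_isUnit (A := fun t => betheHessian T (Ct t) B W) (t₀ := 0)
    (((continuous_const.matrix_mul <| continuous_inv_of_isUnit hcont fun t =>
      (hCt t).isUnit).matrix_mul continuous_const).add continuous_const)
    (fun t => isHermitian_betheHessian (hCt t).isHermitian hB.isHermitian hW.isHermitian)
    (fun t => isUnit_betheHessian (hCt t).isUnit hB.isUnit hW.isUnit hBT (hfix t))
    (by simpa [Ct, betheHessian_fromBlocks hB.isUnit] using posDef_fromBlocks_zero .one hW.inv) 1
  simpa [Ct] using hpos

end BetheHessian

section BlockDiagonal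

variable {o : Type*} [Fintype o] [DecidableEq o] {n : o → Type*} [∀ a, Fintype (n a)]
  {A : ∀ a, Matrix (n a) (n a) ℝ}

theorem blockDiagonal'_mulVec (A : ∀ a, Matrix (n a) (n a) ℝ) (x : (Σ a, n a) → ℝ) (a : o)
    (k : n a) : (Matrix.blockDiagonal' A *ᵥ x) ⟨a, k⟩ = (A a *ᵥ fun k => x ⟨a, k⟩) k := by
  rw [Matrix.mulVec, dotProduct, Fintype.sum_sigma, Finset.sum_eq_single a]
  · simp only [Matrix.blockDiagonal'_apply_eq, Matrix.mulVec, dotProduct]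
  · exact fun b _ hb => Finset.sum_eq_zero fun l _ => by
      rw [Matrix.blockDiagonal'_apply_ne A k l hb.symm, zero_mul]
  · exact fun h => absurd (Finset.mem_univ a) h

theorem blockDiagonal'_mul_apply {m : Type*} (A : ∀ a, Matrix (n a) (n a) ℝ)
    (L : Matrix (Σ a, n a) m ℝ) (a : o) (k : n a) (j : m) :
    (Matrix.blockDiagonal' A * L) ⟨a, k⟩ j = (A a * L.submatrix (Sigma.mk a) id) k j :=
  blockDiagonal'_mulVec A (fun p => L p j) a k

theorem transpose_mul_blockDiagonal'_mul {m : Type*} (L : Matrix (Σ a, n a) m ℝ)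
    (A : ∀ a, Matrix (n a) (n a) ℝ) :
    Lᵀ * Matrix.blockDiagonal' A * L =
      ∑ a, (L.submatrix (Sigma.mk a) id)ᵀ * A a * L.submatrix (Sigma.mk a) id := by
  ext i j
  simp only [Matrix.mul_assoc, Matrix.sum_apply, Matrix.mul_apply (M := Lᵀ), Fintype.sum_sigma,
    blockDiagonal'_mul_apply]
  rfl

theorem posDef_blockDiagonal' {o : Type*} [Finite o] [DecidableEq o] {n : o → Type*}
    [∀ a, Finite (n a)] {A : ∀ a, Matrix (n a) (n a) ℝ} (hA : ∀ a, (A a).PosDef) :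
    (Matrix.blockDiagonal' A).PosDef := by
  have := Fintype.ofFinite o
  have (a : o) := Fintype.ofFinite (n a)
  refine .of_dotProduct_mulVec_pos
    (Matrix.isHermitian_blockDiagonal'_iff.2 fun a => (hA a).isHermitian) fun {x} hx => ?_
  have hquad : star x ⬝ᵥ Matrix.blockDiagonal' A *ᵥ x =
      ∑ a, star (fun k => x ⟨a, k⟩) ⬝ᵥ A a *ᵥ fun k => x ⟨a, k⟩ := by
    simp only [dotProduct, Fintype.sum_sigma, blockDiagonal'_mulVec, Pi.star_apply]
  obtain ⟨⟨a, k⟩, hak⟩ := Function.ne_iff.1 hx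
  rw [hquad]
  exact Finset.sum_pos' (fun b _ => (hA b).posSemidef.dotProduct_mulVec_nonneg _)
    ⟨a, Finset.mem_univ a, (hA a).dotProduct_mulVec_pos (Function.ne_iff.2 ⟨k, hak⟩)⟩

theorem inv_blockDiagonal' [∀ a, DecidableEq (n a)] (hA : ∀ a, IsUnit (A a)) :
    (Matrix.blockDiagonal' A)⁻¹ = Matrix.blockDiagonal' fun a => (A a)⁻¹ := by
  refine Matrix.inv_eq_right_inv ?_
  rw [← Matrix.blockDiagonal'_mul, ← Matrix.blockDiagonal'_one]
  congr 1
  ext1 a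
  exact Matrix.mul_nonsing_inv _ ((Matrix.isUnit_iff_isUnit_det _).1 (hA a))

end BlockDiagonal

section Pullback

variable {l m n : Type*} [DecidableEq n]

/-- The matrix of the linear map `x ↦ x ∘ σ`. -/
def restrict (σ : m → n) : Matrix m n ℝ := (1 : Matrix n n ℝ).submatrix σ id

theorem restrict_mulVec [Fintype n] (σ : m → n) (x : n → ℝ) : restrict σ *ᵥ x = x ∘ σ := by
  ext i
  simp [restrict, Matrix.mulVec, dotProduct, Matrix.one_apply]

theorem restrict_mul [Fintype n] (σ : m → n) (A : Matrix n l ℝ) :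
    restrict σ * A = A.submatrix σ id := by
  ext i j
  exact congrFun (restrict_mulVec σ fun q => A q j) i

theorem restrict_mul_transpose_sub_one_apply [Fintype n] [DecidableEq m] (σ : m → n) (i j : m) :
    (restrict σ * (restrict σ)ᵀ - 1 : Matrix m m ℝ) i j = if σ i = σ j ∧ i ≠ j then 1 else 0 := by
  have hσ : (restrict σ * (restrict σ)ᵀ) i j = if σ i = σ j then 1 else 0 := by
    simp [restrict, Matrix.mul_apply, Matrix.one_apply, eq_comm]
  rw [Matrix.sub_apply, hσ, Matrix.one_apply]
  by_cases hij : i = j <;> simp [hij]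

variable [Fintype m]

/-- The matrix of the quadratic form `x ↦ q (x ∘ σ)`, where `q` is the quadratic form of `A`. -/
def pullback (σ : m → n) (A : Matrix m m ℝ) : Matrix n n ℝ := (restrict σ)ᵀ * A * restrict σ

theorem pullback_sub (σ : m → n) (A B : Matrix m m ℝ) :
    pullback σ (A - B) = pullback σ A - pullback σ B := by
  simp only [pullback, Matrix.mul_sub, Matrix.sub_mul]

theorem pullback_equiv_symm [DecidableEq l] (e : l ≃ m) (A : Matrix m m ℝ) :
    pullback e.symm A = A.submatrix e e := by
  classical
  ext i j
  simp [pullback, restrict, Matrix.mul_apply, Matrix.one_apply, Equiv.symm_apply_eq,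
    Equiv.eq_symm_apply]

variable [DecidableEq m]

theorem restrict_mul_restrict (σ : l → m) (τ : m → n) :
    restrict σ * restrict τ = restrict (τ ∘ σ) :=
  restrict_mul σ _

theorem pullback_pullback [Fintype l] (σ : l → m) (τ : m → n) (A : Matrix l l ℝ) :
    pullback τ (pullback σ A) = pullback (τ ∘ σ) A := by
  simp only [pullback, ← restrict_mul_restrict, Matrix.transpose_mul, Matrix.mul_assoc]

theorem pullback_inr [DecidableEq l] (A : Matrix m m ℝ) :
    pullback (Sum.inr : m → l ⊕ m) A = Matrix.fromBlocks 0 0 0 A := by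
  ext (_ | _) (_ | _) <;> simp [pullback, restrict, Matrix.mul_apply, Matrix.one_apply]

theorem pullback_blockDiagonal' {o : Type*} [Fintype o] [DecidableEq o] {k : o → Type*}
    [∀ a, Fintype (k a)] (σ : (Σ a, k a) → n)
    (A : ∀ a, Matrix (k a) (k a) ℝ) :
    pullback σ (Matrix.blockDiagonal' A) = ∑ a, pullback (fun i => σ ⟨a, i⟩) (A a) :=
  transpose_mul_blockDiagonal'_mul _ A

end Pullback

theorem hasEigenvalue_map_ofReal {n : Type*} [Fintype n] [DecidableEq n] {M : Matrix n n ℝ} {c : ℝ}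
    {v : n → ℝ} (hv : v ≠ 0) (h : M *ᵥ v = c • v) :
    Module.End.HasEigenvalue (Matrix.toLin' (M.map Complex.ofReal)) c := by
  refine Module.End.hasEigenvalue_of_hasEigenvector (x := Complex.ofReal ∘ v)
    ⟨Module.End.mem_eigenspace_iff.2 ?_, fun h0 => hv ?_⟩
  · ext i
    have hmap := RingHom.map_mulVec Complex.ofRealHom M v i
    rw [h, Pi.smul_apply, smul_eq_mul, map_mul] at hmap
    exact hmap.symm
  · ext i
    exact Complex.ofReal_eq_zero.1 (congrFun h0 i)

section EdgeMatrix

variable {V : Type*} [DecidableEq V] {H : Hypergraph V} {r : V → ℕ} {s : H.Factor → ℕ}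

/-- The vertex coordinate `(i, k)` that the edge coordinate `(α → i, k)` is a copy of. -/
def edgeTarget (H : Hypergraph V) (r : V → ℕ) (p : Σ e : H.DirEdge, Fin (r e.2)) :
    Σ i : V, Fin (r i) :=
  ⟨p.1.2, p.2⟩

/-- The companion of `edgeMatrix` that connects the edges of one hyperedge: its
`(α → i, β → j)` block is `u^α_{j → i}` if `j ≠ i` and `β = α`, and `0` otherwise. -/
def siblingMatrix
    (u : ∀ (α : H.Factor) (i j : {i : V // i ∈ α.1}), Matrix (Fin (r j)) (Fin (r i)) ℝ) :
    Matrix (Σ e : H.DirEdge, Fin (r e.2)) (Σ e : H.DirEdge, Fin (r e.2)) ℝ :=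
  Matrix.of fun p q =>
    if h : (q.1.2 : V) ∈ p.1.1.1 ∧ (q.1.2 : V) ≠ p.1.2 ∧ q.1.1 = p.1.1 then
      u p.1.1 ⟨q.1.2, h.1⟩ p.1.2 p.2 q.2 else 0

/-- The coordinates of all `η_α` together, sorted by kind on the left and by hyperedge on the
right. -/
def factorCoordEquiv (H : Hypergraph V) (r : V → ℕ) (s : H.Factor → ℕ) :
    (Σ α : H.Factor, Fin (s α)) ⊕ (Σ e : H.DirEdge, Fin (r e.2)) ≃
      Σ α : H.Factor, Fin (s α) ⊕ Σ i : {i : V // i ∈ α.1}, Fin (r i) :=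
  ((Equiv.refl _).sumCongr (Equiv.sigmaAssoc fun (α : H.Factor) (i : {i : V // i ∈ α.1}) =>
    Fin (r i))).trans (Equiv.sigmaSumDistrib (fun α => Fin (s α)) _).symm

/-- The position of the coordinates of `η_α` among those of `η`. -/
def factorCoord (α : H.Factor) :
    Fin (s α) ⊕ (Σ i : {i : V // i ∈ α.1}, Fin (r i)) →
      (Σ α : H.Factor, Fin (s α)) ⊕ (Σ i : V, Fin (r i)) :=
  Sum.map (fun k => ⟨α, k⟩) fun p => ⟨p.1, p.2⟩

/-- The position of the coordinates of `η_i` among those of `η`. -/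
def vertexCoord (s : H.Factor → ℕ) (i : V) (k : Fin (r i)) :
    (Σ α : H.Factor, Fin (s α)) ⊕ (Σ i : V, Fin (r i)) :=
  Sum.inr ⟨i, k⟩

variable [Fintype V]

theorem blockDiagonal'_mul_restrict_edgeTarget (W : ∀ i, Matrix (Fin (r i)) (Fin (r i)) ℝ) :
    Matrix.blockDiagonal' (fun e : H.DirEdge => W e.2) * restrict (edgeTarget H r) =
      restrict (edgeTarget H r) * Matrix.blockDiagonal' W := by
  ext ⟨e, k⟩ ⟨i, l⟩
  rw [blockDiagonal'_mul_apply, restrict_mul, Matrix.submatrix_apply, edgeTarget, id]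
  by_cases h : e.2 = i
  · subst h
    simp [restrict, Matrix.mul_apply, Matrix.one_apply, edgeTarget]
  · rw [Matrix.blockDiagonal'_apply_ne _ _ _ h]
    simp [restrict, Matrix.mul_apply, Matrix.one_apply, edgeTarget, h]

theorem edgeMatrix_map_ofReal
    (u : ∀ (α : H.Factor) (i j : {i : V // i ∈ α.1}), Matrix (Fin (r j)) (Fin (r i)) ℝ) :
    edgeMatrix (fun α i j => (u α i j).map Complex.ofReal) =
      (siblingMatrix u * (restrict (edgeTarget H r) * (restrict (edgeTarget H r))ᵀ - 1)).map
        Complex.ofReal := by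
  ext ⟨⟨α, i⟩, k⟩ ⟨⟨β, j⟩, l⟩
  simp only [edgeMatrix, Matrix.of_apply, Matrix.map_apply, Matrix.mul_apply,
    restrict_mul_transpose_sub_one_apply, mul_ite, mul_one, mul_zero]
  split_ifs with hfeeds
  · obtain ⟨hj, hji, hβα⟩ := hfeeds
    rw [Finset.sum_eq_single ⟨⟨α, ⟨j, hj⟩⟩, l⟩]
    · have hne : (⟨⟨α, ⟨j, hj⟩⟩, l⟩ : Σ e : H.DirEdge, Fin (r e.2)) ≠ ⟨⟨β, j⟩, l⟩ := by
        rintro ⟨⟩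
        exact hβα rfl
      rw [if_pos ⟨rfl, hne⟩, siblingMatrix, Matrix.of_apply, dif_pos ⟨hj, hji, rfl⟩]
    · rintro ⟨⟨γ, ⟨j', hj'⟩⟩, l'⟩ - hne
      split_ifs with h
      · obtain ⟨⟨⟩⟩ := h.1
        rw [siblingMatrix, Matrix.of_apply, dif_neg]
        rintro ⟨_, _, ⟨⟩⟩
        exact hne rfl
      · rfl
    · simp
  · rw [Finset.sum_eq_zero, Complex.ofReal_zero]
    rintro ⟨⟨γ, ⟨j', hj'⟩⟩, l'⟩ -
    split_ifs with h
    · obtain ⟨⟨⟩⟩ := h.1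
      rw [siblingMatrix, Matrix.of_apply, dif_neg]
      rintro ⟨hj, hji, ⟨⟩⟩
      refine hfeeds ⟨hj, hji, fun h' => h.2 ?_⟩
      cases h'
      rfl
    · rfl

variable {C : ∀ α : H.Factor, Matrix (Fin (s α) ⊕ Σ i : {i : V // i ∈ α.1}, Fin (r i))
    (Fin (s α) ⊕ Σ i : {i : V // i ∈ α.1}, Fin (r i)) ℝ}
  {W : ∀ i, Matrix (Fin (r i)) (Fin (r i)) ℝ}

/-- The weights `u^α_{i → j}` in terms of the factor covariances `C` and the vertex variances
`W`. -/
def edgeWeight (C : ∀ α : H.Factor, Matrix (Fin (s α) ⊕ Σ i : {i : V // i ∈ α.1}, Fin (r i))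
      (Fin (s α) ⊕ Σ i : {i : V // i ∈ α.1}, Fin (r i)) ℝ)
    (W : ∀ i, Matrix (Fin (r i)) (Fin (r i)) ℝ) (α : H.Factor) (i j : {i : V // i ∈ α.1}) :
    Matrix (Fin (r j)) (Fin (r i)) ℝ :=
  (W j)⁻¹ * (C α).submatrix (fun k => Sum.inr ⟨j, k⟩) (fun k => Sum.inr ⟨i, k⟩)

theorem edgeOperator_blockDiagonal' (hW : ∀ i, IsUnit (W i))
    (hCW : ∀ α (i : {i : V // i ∈ α.1}),
      (C α).submatrix (fun k => Sum.inr ⟨i, k⟩) (fun k => Sum.inr ⟨i, k⟩) = W i) :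
    edgeOperator (restrict (edgeTarget H r))
        ((Matrix.blockDiagonal' C).submatrix (factorCoordEquiv H r s)
          (factorCoordEquiv H r s)).toBlocks₂₂
        (Matrix.blockDiagonal' fun e : H.DirEdge => W e.2) =
      siblingMatrix (edgeWeight C W) *
        (restrict (edgeTarget H r) * (restrict (edgeTarget H r))ᵀ - 1) := by
  rw [edgeOperator, inv_blockDiagonal' fun e => hW e.2]
  congr 1
  ext ⟨⟨α, i⟩, k⟩ ⟨⟨β, j⟩, l⟩
  have hK (m : Fin (r i)) : ((Matrix.blockDiagonal' C).submatrix (factorCoordEquiv H r s)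
      (factorCoordEquiv H r s)).toBlocks₂₂ ⟨⟨α, i⟩, m⟩ ⟨⟨β, j⟩, l⟩ =
      Matrix.blockDiagonal' C ⟨α, Sum.inr ⟨i, m⟩⟩ ⟨β, Sum.inr ⟨j, l⟩⟩ := rfl
  rw [blockDiagonal'_mul_apply, Matrix.mul_apply, siblingMatrix, Matrix.of_apply]
  simp only [edgeWeight, Matrix.submatrix_apply, Matrix.sub_apply, hK, id]
  rcases eq_or_ne α β with rfl | hαβ
  · rcases eq_or_ne i j with rfl | hij
    · rw [dif_neg fun h => h.2.1 rfl]
      refine Finset.sum_eq_zero fun m _ => mul_eq_zero_of_right _ (sub_eq_zero.2 ?_)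
      rw [Matrix.blockDiagonal'_apply_eq, Matrix.blockDiagonal'_apply_eq]
      exact congrFun₂ (hCW α i) m l
    · rw [dif_pos ⟨j.2, Subtype.coe_injective.ne hij.symm, rfl⟩]
      refine Finset.sum_congr rfl fun m _ => ?_
      have hne : (⟨α, i⟩ : H.DirEdge) ≠ ⟨α, j⟩ := by simpa using hij
      rw [Matrix.blockDiagonal'_apply_eq, Matrix.blockDiagonal'_apply_ne _ _ _ hne, sub_zero]
      rfl
  · have hne : (⟨α, i⟩ : H.DirEdge) ≠ ⟨β, j⟩ := fun h => hαβ (congrArg Sigma.fst h)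
    rw [dif_neg fun h => hαβ h.2.2.symm]
    refine Finset.sum_eq_zero fun m _ => mul_eq_zero_of_right _ ?_
    rw [Matrix.blockDiagonal'_apply_ne _ _ _ hαβ, Matrix.blockDiagonal'_apply_ne _ _ _ hne,
      sub_zero]

theorem sum_dirEdge {M : Type*} [AddCommMonoid M] [Module ℝ M] (f : V → M) :
    ∑ e : H.DirEdge, f e.2 = ∑ i, (H.degree i : ℝ) • f i := by
  have hvertex (α : H.Factor) :
      ∑ i : {i : V // i ∈ α.1}, f i = ∑ i, if i ∈ α.1 then f i else 0 := by
    rw [Finset.sum_coe_sort α.1 f, Finset.sum_ite_mem, Finset.univ_inter]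
  have hfactor (i : V) : ∑ α : H.Factor, (if i ∈ α.1 then f i else 0) = (H.degree i : ℝ) • f i := by
    rw [Finset.sum_coe_sort H.hyperedges fun α => if i ∈ α then f i else 0, ← Finset.sum_filter,
      Finset.sum_const, Nat.cast_smul_eq_nsmul, Hypergraph.degree]
  simp only [Fintype.sum_sigma, hvertex, ← hfactor]
  exact Finset.sum_comm

theorem betheHessian_blockDiagonal' (hC : ∀ α, IsUnit (C α)) (hW : ∀ i, IsUnit (W i)) :
    betheHessian (restrict (edgeTarget H r))
        ((Matrix.blockDiagonal' C).submatrix (factorCoordEquiv H r s) (factorCoordEquiv H r s))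
        (Matrix.blockDiagonal' fun e : H.DirEdge => W e.2) (Matrix.blockDiagonal' W) =
      ∑ α, pullback (factorCoord α) (C α)⁻¹ +
        ∑ i, (1 - (H.degree i : ℝ)) • pullback (vertexCoord s i) (W i)⁻¹ := by
  have hglue : gluing (Σ α : H.Factor, Fin (s α)) (restrict (edgeTarget H r)) =
      restrict (Sum.map id (edgeTarget H r)) := by
    ext (_ | _) (_ | _) <;> simp [gluing, restrict, Matrix.one_apply]
  have hfactor : pullback (Sum.map id (edgeTarget H r)) ((Matrix.blockDiagonal' C).submatrix
      (factorCoordEquiv H r s) (factorCoordEquiv H r s))⁻¹ =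
      ∑ α, pullback (factorCoord α) (C α)⁻¹ := by
    rw [Matrix.inv_submatrix_equiv, inv_blockDiagonal' hC, ← pullback_equiv_symm,
      pullback_pullback, pullback_blockDiagonal']
    refine Finset.sum_congr rfl fun α _ => congrArg (pullback · _) ?_
    ext (_ | _) <;> rfl
  have hedge : pullback Sum.inr (pullback (edgeTarget H r)
      (Matrix.blockDiagonal' fun e : H.DirEdge => W e.2)⁻¹) =
      ∑ i, (H.degree i : ℝ) • pullback (vertexCoord s i) (W i)⁻¹ := by
    rw [inv_blockDiagonal' fun e => hW e.2, pullback_pullback, pullback_blockDiagonal',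
      ← sum_dirEdge]
    rfl
  have hvertex : pullback Sum.inr (Matrix.blockDiagonal' W)⁻¹ =
      ∑ i, pullback (vertexCoord s i) (W i)⁻¹ := by
    rw [inv_blockDiagonal' hW, pullback_blockDiagonal']
    rfl
  rw [betheHessian, hglue, ← pullback, ← pullback, hfactor, ← pullback_inr, pullback_sub, hvertex,
    hedge]
  simp only [sub_smul, one_smul, Finset.sum_sub_distrib]

theorem posDef_sum_pullback (hC : ∀ α, (C α).PosDef) (hW : ∀ i, (W i).PosDef)
    (hCW : ∀ α (i : {i : V // i ∈ α.1}),
      (C α).submatrix (fun k => Sum.inr ⟨i, k⟩) (fun k => Sum.inr ⟨i, k⟩) = W i)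
    (hM : ∀ c : ℝ, 1 ≤ c → ¬ Module.End.HasEigenvalue (Matrix.toLin' (edgeMatrix fun α i j =>
      (edgeWeight C W α i j).map Complex.ofReal)) (c : ℂ)) :
    (∑ α, pullback (factorCoord α) (C α)⁻¹ +
      ∑ i, (1 - (H.degree i : ℝ)) • pullback (vertexCoord s i) (W i)⁻¹).PosDef := by
  rw [← betheHessian_blockDiagonal' (fun α => (hC α).isUnit) fun i => (hW i).isUnit]
  refine posDef_betheHessian ((posDef_blockDiagonal' hC).submatrix (Equiv.injective _))
    (posDef_blockDiagonal' fun e : H.DirEdge => hW e.2) (posDef_blockDiagonal' hW)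
    (blockDiagonal'_mul_restrict_edgeTarget W) fun c hc f hf => ?_
  rw [edgeOperator_blockDiagonal' (fun i => (hW i).isUnit) hCW] at hf
  by_contra hf0
  refine hM c hc ?_
  rw [edgeMatrix_map_ofReal]
  exact hasEigenvalue_map_ofReal hf0 hf

end EdgeMatrix

theorem HasHessianAt.comp_restrict {m n : Type*} [Fintype m] [Fintype n] [DecidableEq n]
    {σ : m → n} {f : (m → ℝ) → ℝ} {A : Matrix m m ℝ} {x : n → ℝ}
    (hf : HasHessianAt f A (x ∘ σ)) :
    HasHessianAt (fun y => f (y ∘ σ)) (pullback σ A) x := by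
  rw [← restrict_mulVec] at hf
  simpa only [restrict_mulVec] using! hf.comp_mulVec

namespace InferenceFamily

variable {V : Type*} [DecidableEq V] {H : Hypergraph V} {X : V → Type*}
  [∀ i, MeasurableSpace (X i)] (I : InferenceFamily H X)

theorem measurable_φFactor (α : H.Factor) : Measurable (I.φFactor α) := by
  refine measurable_pi_iff.2 ?_
  rintro (k | ⟨i, k⟩)
  · exact (measurable_pi_apply k).comp (I.measurable_φF α)
  · exact (measurable_pi_apply k).comp ((I.measurable_φ i).comp (measurable_pi_apply i))

theorem isRegularFamily_vertex (i : V) : IsRegularFamily (I.ν i) (I.φ i) :=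
  ⟨(I.measurable_φ i).aestronglyMeasurable, I.isUnit_hessian_vertex i⟩

theorem isRegularFamily_factor (α : H.Factor) : IsRegularFamily (I.νFactor α) (I.φFactor α) :=
  ⟨(I.measurable_φFactor α).aestronglyMeasurable, I.isUnit_hessian_factor α⟩

/-- The covariance matrix `Var_{b_α}(φ_α)` of the factor belief given by `η`. -/
def factorCov (η : I.Coord → ℝ) (α : H.Factor) : Matrix (I.FactorIdx α) (I.FactorIdx α) ℝ :=
  covMatrix (I.beliefFactor η α) (I.φFactor α) (I.φFactor α)

/-- The covariance matrix `Var_{b_i}(φ_i)` of the vertex belief given by `η`. -/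
def vertexCov (η : I.Coord → ℝ) (i : V) : Matrix (Fin (I.r i)) (Fin (I.r i)) ℝ :=
  covMatrix (I.beliefVertex η i) (I.φ i) (I.φ i)

theorem weight_eq_edgeWeight (η : I.Coord → ℝ) :
    I.weight η = edgeWeight (I.factorCov η) (I.vertexCov η) :=
  rfl

theorem etaFactor_eq_comp (η : I.Coord → ℝ) (α : H.Factor) :
    I.etaFactor η α = η ∘ factorCoord α := by
  ext (_ | _) <;> rfl

variable {I} {η : I.Coord → ℝ}

theorem posDef_factorCov (hη : η ∈ I.L) (α : H.Factor) : (I.factorCov η α).PosDef :=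
  (I.isRegularFamily_factor α).posDef_covMatrix_distOfMean (hη.1 α)

theorem posDef_vertexCov (hη : η ∈ I.L) (i : V) : (I.vertexCov η i).PosDef :=
  (I.isRegularFamily_vertex i).posDef_covMatrix_distOfMean (hη.2 i)

theorem map_beliefFactor (hη : η ∈ I.L) (α : H.Factor) (i : {i : V // i ∈ α.1}) :
    (I.beliefFactor η α).map (fun x => x i) = I.beliefVertex η i := by
  obtain ⟨θ, hθ, hmap⟩ := I.marginally_closed α i _ (naturalParam_mem (hη.1 α))
  have hmean : expectationMap (I.ν i) (I.φ i) θ = I.etaVertex η i := by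
    ext k
    have hk : Measurable fun x => I.φ i x k := (measurable_pi_apply k).comp (I.measurable_φ i)
    rw [expectationMap, ← hmap,
      integral_map (measurable_pi_apply i).aemeasurable hk.aestronglyMeasurable]
    exact congrFun (expectationMap_naturalParam (hη.1 α)) (Sum.inr ⟨i, k⟩)
  have hparam : naturalParam (I.ν i) (I.φ i) (I.etaVertex η i) = θ :=
    hmean ▸ (I.isRegularFamily_vertex i).naturalParam_expectationMap hθ
  exact hmap.trans (congrArg (expDist (I.ν i) (I.φ i)) hparam.symm)

theorem factorCov_submatrix (hη : η ∈ I.L) (α : H.Factor) (i : {i : V // i ∈ α.1}) :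
    (I.factorCov η α).submatrix (fun k => Sum.inr ⟨i, k⟩) (fun k => Sum.inr ⟨i, k⟩) =
      I.vertexCov η i := by
  have hφ (k : Fin (I.r i)) : Measurable fun x => I.φ i x k :=
    (measurable_pi_apply k).comp (I.measurable_φ i)
  ext k l
  rw [vertexCov, ← map_beliefFactor hη α i, covMatrix_apply,
    covariance_map (hφ k).aestronglyMeasurable (hφ l).aestronglyMeasurable
      (measurable_pi_apply i).aemeasurable]
  rfl

theorem hasHessianAt_betheFreeEnergy [Fintype V] (hη : η ∈ I.L)
    (θbar : ∀ α : H.Factor, I.FactorIdx α → ℝ) :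
    HasHessianAt (I.betheFreeEnergy θbar)
      (∑ α, pullback (factorCoord α) (I.factorCov η α)⁻¹ +
        ∑ i, (1 - (H.degree i : ℝ)) • pullback (vertexCoord I.s i) (I.vertexCov η i)⁻¹) η := by
  have hlinear (α : H.Factor) : HasHessianAt (fun η => θbar α ⬝ᵥ I.etaFactor η α) 0 η := by
    have h := (hasHessianAt_dotProduct (θbar α) (η ∘ factorCoord α)).comp_restrict
    simpa only [etaFactor_eq_comp, pullback, Matrix.mul_zero, Matrix.zero_mul] using h
  have hfactor (α : H.Factor) :
      HasHessianAt (fun η => legendre (I.νFactor α) (I.φFactor α) (I.etaFactor η α))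
        (pullback (factorCoord α) (I.factorCov η α)⁻¹) η := by
    have h : HasHessianAt (legendre (I.νFactor α) (I.φFactor α)) (I.factorCov η α)⁻¹
        (η ∘ factorCoord α) := by
      rw [← etaFactor_eq_comp]
      exact (I.isRegularFamily_factor α).hasHessianAt_legendre (hη.1 α)
    simpa only [etaFactor_eq_comp] using h.comp_restrict
  have hvertex (i : V) : HasHessianAt (fun η => legendre (I.ν i) (I.φ i) (I.etaVertex η i))
      (pullback (vertexCoord I.s i) (I.vertexCov η i)⁻¹) η :=
    ((I.isRegularFamily_vertex i).hasHessianAt_legendre (hη.2 i)).comp_restrict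
  have h := (((HasHessianAt.sum Finset.univ fun α _ => hlinear α).const_mul (-1)).add
    (.sum Finset.univ fun α _ => hfactor α)).add
    (.sum Finset.univ fun i _ => (hvertex i).const_mul (1 - (H.degree i : ℝ)))
  simpa only [neg_one_mul, Finset.sum_const_zero, smul_zero, zero_add] using! h

end InferenceFamily

end Bethe

end

theorem theorem5 {V : Type*} [Fintype V] [DecidableEq V] {H : Bethe.Hypergraph V}
    {X : V → Type*} [∀ i, MeasurableSpace (X i)] (I : Bethe.InferenceFamily H X)
    (θbar : ∀ α : H.Factor, I.FactorIdx α → ℝ) (η : I.Coord → ℝ) (hη : η ∈ I.L)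
    (hspec : ∀ z : ℂ,
      Module.End.HasEigenvalue (Matrix.toLin'
        (Bethe.edgeMatrix fun α i j => (I.weight η α i j).map (fun t : ℝ => (t : ℂ)))) z →
      ¬ ∃ t : ℝ, 1 ≤ t ∧ z = (t : ℂ)) :
    ContDiffAt ℝ 2 (I.betheFreeEnergy θbar) η ∧
      (Bethe.hessian (I.betheFreeEnergy θbar) η).PosDef := by
  have hH := I.hasHessianAt_betheFreeEnergy hη θbar
  refine ⟨hH.contDiffAt, hH.hessian_eq ▸ Bethe.posDef_sum_pullback (I.posDef_factorCov hη)
    (I.posDef_vertexCov hη) (I.factorCov_submatrix hη) fun c hc hev => ?_⟩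
  exact hspec c (I.weight_eq_edgeWeight η ▸ hev) ⟨c, hc, rfl⟩
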